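/- **Laakso graphs.** Let $G_0$ be a single edge of length $1$. For $m\ge 0$, $G_{m+1}$ is obtained from six copies of $G_m$, with metric scaled by $\frac14$, by gluing four of them cyclically along their endpoints (the endpoints of $G_m$ being its two vertices of degree one) and attaching each of the other two copies, by one of its endpoints, at one of two opposite gluing points. Thus every edge of $G_m$ has length $4^{-m}$. The vertex set of $G_m$ is equipped with the shortest path metric, and $|G_m|$ denotes the number of its vertices. For metric spaces $M,N$ let $c_M(N)$ be the infimum of those $D>0$ for which there are $r>0$ and $f:N\to M$ with $r\,d_N(x,y)\le d_M(f(x),f(y))\le D\,r\,d_N(x,y)$ for all $x,y\in N$ (and $c_M(N)=\infty$ if there is no such $D$). **$p$-convexity.** A Banach space $(X,\|\cdot\|)$ is $p$-convex if it has an equivalent norm $N$ and a constant $K>0$ such that $N(x)=N(y)=1$ implies $N\left(\frac{x+y}{2}\right)\le 1-K\,N(x-y)^p$. **Markov $p$-convexity.** A metric space $(X,d)$ is Markov $p$-convex with constant $\Pi\ge 0$ if for every (discrete, not necessarily time-homogeneous) Markov chain $\{X_t\}_{t\in\mathbb Z}$ on a set $\Omega$ and every $f:\Omega\to X$, $$\sum_{k=0}^\infty\sum_{t\in\mathbb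 Z}\frac{\mathbb E\left[d\left(f(X_t),f(\widetilde X_t(t-2^k))\right)^p\right]}{2^{kp}}\le \Pi^p\sum_{t\in\mathbb Z}\mathbb E\left[d(f(X_t),f(X_{t-1}))^p\right],$$ where $\{\widetilde X_t(s)\}_{t\in\mathbb Z}$ equals $X_t$ for $t\le s$ and evolves independently of $X$, with the same transition probabilities, for $t>s$. **Theorem.** 1. Let $p\ge 2$ and let $X$ be a $p$-convex Banach space. Then there is $c>0$ (depending on $p$ and $X$) such that $c_X(G_m)\ge c\,(\log|G_m|)^{1/p}$ for all $m\ge 0$. 2. There is a universal constant $c>0$ such that $c_{L_p(\mu)}(G_m)\ge c\,(\log|G_m|)^{1/p}$ for all $p\in(2,\infty)$, all measures $\mu$ and all $m\ge 0$. 3. There is a universal constant $c>0$ such that for every $p\ge 2$, every metric space $X$ which is Markov $p$-convex with constant $\Pi>0$, and all $m\ge 0$, $$c_X(G_m)\ge \frac{c}{\Pi}\,(\log|G_m|)^{1/p}.$$ -/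

import Mathlib

open scoped ENNReal NNReal

/-! ### Laakso graphs -/

/-- The vertices of the `m`-th Laakso graph other than its two endpoints. The graph of index `m + 1`
has the four vertices `Sum.inl j` at which copies of the graph of index `m` are glued together, and,
for each of the six copies `e`, the non-endpoint vertices `Sum.inr (e, v)` of that copy. -/
def LaaksoInner : ℕ → Type
  | 0 => Empty
  | m + 1 => Fin 4 ⊕ (Fin 6 × LaaksoInner m)

/-- The vertices of the `m`-th Laakso graph: the two endpoints `Sum.inl false`, `Sum.inl true`
(the only vertices of degree one) and the remaining vertices. -/
def LaaksoVertex (m : ℕ) : Type := Bool ⊕ LaaksoInner m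

namespace LaaksoVertex

/-- The endpoint of the `m`-th Laakso graph that serves as its root. -/
def source (m : ℕ) : LaaksoVertex m := Sum.inl false

/-- The endpoint of the `m`-th Laakso graph opposite to the root. -/
def sink (m : ℕ) : LaaksoVertex m := Sum.inl true

/-- The four gluing points of the graph of index `m + 1`. -/
def junction (m : ℕ) (j : Fin 4) : LaaksoVertex (m + 1) := Sum.inr (Sum.inl j)

/-- The point to which the root of the `e`-th copy is glued. The copies `1, 2, 3, 4` form a cycle
through the gluing points `0, 1, 3, 2`; the copy `0` is attached at `0` and the copy `5` is attached
at the opposite gluing point `3`. -/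
def tail (m : ℕ) : Fin 6 → LaaksoVertex (m + 1) :=
  ![source (m + 1), junction m 0, junction m 0, junction m 1, junction m 2, junction m 3]

/-- The point to which the other endpoint of the `e`-th copy is glued. -/
def head (m : ℕ) : Fin 6 → LaaksoVertex (m + 1) :=
  ![junction m 0, junction m 1, junction m 2, junction m 3, junction m 3, sink (m + 1)]

/-- The inclusion of the `e`-th copy of the graph of index `m` in the graph of index `m + 1`. -/
def copy (m : ℕ) (e : Fin 6) : LaaksoVertex m → LaaksoVertex (m + 1)
  | Sum.inl false => tail m e
  | Sum.inl true => head m e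
  | Sum.inr v => Sum.inr (Sum.inr (e, v))

end LaaksoVertex

/-- The `m`-th Laakso graph: a single edge for `m = 0`; the edges of the graph of index `m + 1` are
the edges of the six copies of the graph of index `m`. -/
def laaksoGraph : (m : ℕ) → SimpleGraph (LaaksoVertex m)
  | 0 => ⊤
  | m + 1 => SimpleGraph.fromRel fun u v =>
      ∃ (e : Fin 6) (x y : LaaksoVertex m), (laaksoGraph m).Adj x y ∧
        u = LaaksoVertex.copy m e x ∧ v = LaaksoVertex.copy m e y

instance LaaksoInner.instFintype : (m : ℕ) → Fintype (LaaksoInner m)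
  | 0 => inferInstanceAs (Fintype Empty)
  | m + 1 =>
    letI := LaaksoInner.instFintype m
    inferInstanceAs (Fintype (Fin 4 ⊕ (Fin 6 × LaaksoInner m)))

instance LaaksoVertex.instFintype (m : ℕ) : Fintype (LaaksoVertex m) :=
  inferInstanceAs (Fintype (Bool ⊕ LaaksoInner m))

theorem LaaksoVertex.reachable_copy (m : ℕ) (h : (laaksoGraph m).Connected) (e : Fin 6)
    (x y : LaaksoVertex m) :
    (laaksoGraph (m + 1)).Reachable (copy m e x) (copy m e y) := by
  obtain ⟨w⟩ := h.preconnected x y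
  induction w with
  | nil => exact SimpleGraph.Reachable.refl _
  | @cons a b c hab _ ih =>
    refine SimpleGraph.Reachable.trans ?_ ih
    by_cases hne : copy m e a = copy m e b
    · rw [hne]
    · refine SimpleGraph.Adj.reachable ?_
      rw [laaksoGraph, SimpleGraph.fromRel_adj]
      exact ⟨hne, Or.inl ⟨e, a, b, hab, rfl, rfl⟩⟩

theorem laaksoGraph_connected (m : ℕ) : (laaksoGraph m).Connected := by
  induction m with
  | zero =>
    have : Nonempty (LaaksoVertex 0) := ⟨LaaksoVertex.source 0⟩
    exact SimpleGraph.connected_top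
  | succ m h =>
    have key (e : Fin 6) : (laaksoGraph (m + 1)).Reachable
        (LaaksoVertex.tail m e) (LaaksoVertex.head m e) :=
      LaaksoVertex.reachable_copy m h e (Sum.inl false) (Sum.inl true)
    have h0 := key 0
    have h1 := h0.trans (key 1)
    have h2 := h0.trans (key 2)
    have h3 := h1.trans (key 3)
    have h5 := h3.trans (key 5)
    have hj : ∀ j, (laaksoGraph (m + 1)).Reachable (LaaksoVertex.source (m + 1))
        (LaaksoVertex.junction m j) := by
      intro j
      fin_cases j
      exacts [h0, h1, h2, h3]
    have ht : ∀ e, (laaksoGraph (m + 1)).Reachable (LaaksoVertex.source (m + 1))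
        (LaaksoVertex.tail m e) := by
      intro e
      fin_cases e
      exacts [SimpleGraph.Reachable.refl _, h0, h0, h1, h2, h3]
    have hall : ∀ v, (laaksoGraph (m + 1)).Reachable (LaaksoVertex.source (m + 1)) v := by
      rintro ((_ | _) | j | ⟨e, v⟩)
      · exact SimpleGraph.Reachable.refl _
      · exact h5
      · exact hj j
      · exact (ht e).trans
          (LaaksoVertex.reachable_copy m h e (Sum.inl false) (Sum.inr v))
    exact { preconnected := fun u v => (hall u).symm.trans (hall v)
            nonempty := ⟨LaaksoVertex.source (m + 1)⟩ }

/-- The vertex set of the `m`-th Laakso graph with the shortest path metric in which every edge has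
length `4 ^ (-m)`. -/
noncomputable instance LaaksoVertex.instMetricSpace (m : ℕ) : MetricSpace (LaaksoVertex m) where
  dist u v := ((laaksoGraph m).dist u v : ℝ) / 4 ^ m
  dist_self u := by simp
  dist_comm u v := by rw [SimpleGraph.dist_comm]
  dist_triangle u v w := by
    rw [← add_div]
    gcongr
    exact_mod_cast (laaksoGraph_connected m).dist_triangle
  eq_of_dist_eq_zero {u v} h := by
    have h4 : (4 : ℝ) ^ m ≠ 0 := by positivity
    have h0 : (laaksoGraph m).dist u v = 0 := by
      have := (div_eq_zero_iff.mp h).resolve_right h4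
      exact_mod_cast this
    exact (laaksoGraph_connected m).dist_eq_zero_iff.mp h0

/-! ### Bi-Lipschitz distortion -/

/-- The smallest bi-Lipschitz distortion with which `N` embeds into `M`: the infimum of those `D > 0`
for which some `f : N → M` and some scaling factor `r > 0` satisfy
`r * dist x y ≤ dist (f x) (f y) ≤ D * r * dist x y` for all `x y`; it is `∞` if there is no such `D`. -/
noncomputable def leastDistortion (N M : Type*) [MetricSpace N] [MetricSpace M] : ℝ≥0∞ :=
  ⨅ D ∈ {D : ℝ | 0 < D ∧ ∃ r : ℝ, 0 < r ∧ ∃ f : N → M, ∀ x y : N,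
    r * dist x y ≤ dist (f x) (f y) ∧ dist (f x) (f y) ≤ D * r * dist x y}, ENNReal.ofReal D

/-! ### Uniform convexity of power type -/

/-- A normed space is `p`-convex if it has an equivalent norm `N` whose modulus of uniform convexity
is of power type `p`. -/
def IsPConvex (p : ℝ) (X : Type*) [NormedAddCommGroup X] [NormedSpace ℝ X] : Prop :=
  ∃ (N : Seminorm ℝ X) (a b K : ℝ), 0 < a ∧ 0 < b ∧ 0 < K ∧
    (∀ x, a * ‖x‖ ≤ N x ∧ N x ≤ b * ‖x‖) ∧
    ∀ x y, N x = 1 → N y = 1 → N ((1 / 2 : ℝ) • (x + y)) ≤ 1 - K * N (x - y) ^ p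

/-! ### Markov convexity -/

/-- A (not necessarily time-homogeneous) Markov chain `(X_t)` indexed by the integers, with values in
a set `Ω`, given by the distribution of each `X_t` and by the transition probabilities
`trans t x y = ℙ (X_{t+1} = y | X_t = x)`. -/
structure IntMarkovChain (Ω : Type*) where
  /-- The distribution of `X_t`. -/
  law : ℤ → PMF Ω
  /-- The transition probabilities from time `t` to time `t + 1`. -/
  trans : ℤ → Ω → PMF Ω
  law_succ : ∀ t, (law t).bind (trans t) = law (t + 1)

namespace IntMarkovChain

variable {Ω : Type*}

/-- The distribution of `X_{s+n}` conditioned on `X_s = x`. -/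
noncomputable def evolve (Z : IntMarkovChain Ω) (s : ℤ) : ℕ → Ω → PMF Ω
  | 0, x => PMF.pure x
  | n + 1, x => (Z.evolve s n x).bind (Z.trans (s + n))

/-- The joint distribution of `(X_{s+n}, X_s)`. -/
noncomputable def pair (Z : IntMarkovChain Ω) (s : ℤ) (n : ℕ) : PMF (Ω × Ω) :=
  (Z.law s).bind fun w => (Z.evolve s n w).map fun x => (x, w)

/-- The joint distribution of `(X_{s+n}, Y_{s+n})`, where the process `Y` equals `X` up to time `s` and
evolves after time `s` independently of `X`, with the same transition probabilities. -/
noncomputable def fork (Z : IntMarkovChain Ω) (s : ℤ) (n : ℕ) : PMF (Ω × Ω) :=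
  (Z.law s).bind fun w =>
    (Z.evolve s n w).bind fun x => (Z.evolve s n w).map fun y => (x, y)

end IntMarkovChain

/-- The expectation of `d(f(x), f(y)) ^ p` for a random pair `(x, y)` with distribution `P`. -/
noncomputable def expDistPow {Ω X : Type*} [MetricSpace X] (p : ℝ) (f : Ω → X) (P : PMF (Ω × Ω)) :
    ℝ≥0∞ :=
  ∑' z : Ω × Ω, P z * edist (f z.1) (f z.2) ^ p

/-- `X` is Markov `p`-convex with constant `C`. The summand on the left is the expectation of
`d(f(X_t), f(Y_t)) ^ p / 2 ^ (k * p)`, where `Y` branches off from `X` at time `t - 2 ^ k`. -/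
def IsMarkovConvexWith (p : ℝ) (C : ℝ≥0) (X : Type*) [MetricSpace X] : Prop :=
  ∀ (Ω : Type) (Z : IntMarkovChain Ω) (f : Ω → X),
    ∑' (k : ℕ) (t : ℤ), expDistPow p f (Z.fork (t - 2 ^ k) (2 ^ k)) / 2 ^ ((k : ℝ) * p) ≤
      (C : ℝ≥0∞) ^ p * ∑' t : ℤ, expDistPow p f (Z.pair (t - 1) 1)

/-! ### Distances in graphs and in the Laakso graphs -/

/-! Since the logarithm of the number of vertices is at most `2 * (m + 1)`, it suffices to bound the
`p`-th power of the distortion from below by a multiple of `m + 1`. Each of the `m` scales of the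
graph contributes a fixed amount.

For normed spaces, a modulus of power type `p` yields the inequality `IsTwoPointConvex`
(`exists_isTwoPointConvex`); for `L_p` this is Clarkson's inequality, with constant `1`. Applied to
both paths around the cycle, it shows that the `p`-th power of the mean displacement between the
endpoints falls short of a weighted mean over the six copies by a multiple of the `p`-th power of
the displacement across the cycle (`laakso_step`). The image cannot collapse the cycle, so every
level loses at least `K / 2 * r ^ p`, and induction on `m` gives `1 + m * (K / 2) ≤ D ^ p`.

For Markov convexity, a walk crosses the graph in `4 ^ m` steps and chooses a branch by a fair bit
at each fork. Every step moves at most one edge, which bounds the right-hand side. For each level `i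
< m` and at least one eighth of the times `t`, restarting at `t - 4 ^ i` redraws the branch of level
`i` and none above it; with probability one half the two walks are then `4 ^ i` edges apart. The
weight at `k = 2 * i` cancels the factor `4 ^ (i * p)`, so all levels contribute alike and `m ≤ 16 *
C ^ p * D ^ p`. The constant term missing here comes from a lower bound on `C` itself
(`one_le_of_ne`). -/

theorem SimpleGraph.dist_map_le_of_adj {V W : Type*} {G : SimpleGraph V} {H : SimpleGraph W}
    (hG : G.Connected) (hH : H.Connected) (g : V → W)
    (hg : ∀ a b, G.Adj a b → g a = g b ∨ H.Adj (g a) (g b)) (a b : V) :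
    H.dist (g a) (g b) ≤ G.dist a b := by
  obtain ⟨w, hw⟩ := hG.exists_walk_length_eq_dist a b
  rw [← hw]
  clear hw
  induction w with
  | nil => simp
  | @cons a b c hab _ ih =>
    rw [SimpleGraph.Walk.length_cons]
    have h1 : H.dist (g a) (g b) ≤ 1 := by
      rcases hg a b hab with h | h
      · rw [h]; simp
      · exact (SimpleGraph.dist_eq_one_iff_adj.mpr h).le
    have := hH.dist_triangle (u := g a) (v := g b) (w := g c)
    omega

theorem SimpleGraph.abs_sub_le_dist_of_adj {V : Type*} {G : SimpleGraph V}
    (hG : G.Connected) (g : V → ℤ) (hg : ∀ a b, G.Adj a b → |g a - g b| ≤ 1) (a b : V) :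
    |g a - g b| ≤ G.dist a b := by
  obtain ⟨w, hw⟩ := hG.exists_walk_length_eq_dist a b
  rw [← hw]
  clear hw
  induction w with
  | nil => simp
  | @cons a b c hab _ ih =>
    rw [SimpleGraph.Walk.length_cons]
    have h1 := hg a b hab
    push_cast
    calc |g a - g c| ≤ |g a - g b| + |g b - g c| := abs_sub_le _ _ _
      _ ≤ _ := by linarith

namespace LaaksoVertex

/-- The number of copies that precede the `e`-th copy on a geodesic from the root. -/
def layer : Fin 6 → ℕ := ![0, 1, 1, 2, 2, 3]

/-- The number of copies that precede the `j`-th gluing point on a geodesic from the root. -/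
def depth : Fin 4 → ℕ := ![1, 2, 2, 3]

/-- The depth of an endpoint of one of the six copies, and a larger value at all other vertices. -/
def endpointDepth (m : ℕ) : LaaksoVertex (m + 1) → ℕ
  | Sum.inl false => 0
  | Sum.inl true => 4
  | Sum.inr (Sum.inl j) => depth j
  | Sum.inr (Sum.inr _) => 5

theorem endpointDepth_tail (m : ℕ) (e : Fin 6) : endpointDepth m (tail m e) = layer e := by
  fin_cases e <;> rfl

theorem endpointDepth_head (m : ℕ) (e : Fin 6) : endpointDepth m (head m e) = layer e + 1 := by
  fin_cases e <;> rfl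

theorem layer_lt (e : Fin 6) : layer e < 4 := by
  fin_cases e <;> decide

/-- `endpointDepth` takes the distinct values `layer e`, `layer e + 1` and `5` on the root, the
opposite endpoint and the inner vertices of a copy, so gluing never identifies the two ends of one
copy. -/
theorem copy_injective (m : ℕ) (e : Fin 6) : Function.Injective (copy m e) := by
  have h1 := endpointDepth_tail m e
  have h2 := endpointDepth_head m e
  have h3 := layer_lt e
  have h4 : ∀ v, endpointDepth m (copy m e (Sum.inr v)) = 5 := fun _ => rfl
  intro x y h
  have h' := congrArg (endpointDepth m) h
  rcases x with (_ | _) | x <;> rcases y with (_ | _) | y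
  · rfl
  · change endpointDepth m (tail m e) = endpointDepth m (head m e) at h'
    omega
  · rw [h4] at h'
    change endpointDepth m (tail m e) = 5 at h'
    omega
  · change endpointDepth m (head m e) = endpointDepth m (tail m e) at h'
    omega
  · rfl
  · rw [h4] at h'
    change endpointDepth m (head m e) = 5 at h'
    omega
  · rw [h4] at h'
    change 5 = endpointDepth m (tail m e) at h'
    omega
  · rw [h4] at h'
    change 5 = endpointDepth m (head m e) at h'
    omega
  · have h' : (e, x) = (e, y) := Sum.inr.inj (Sum.inr.inj h)
    rw [(Prod.mk.inj h').2]

theorem adj_succ_iff {m : ℕ} {u v : LaaksoVertex (m + 1)} : (laaksoGraph (m + 1)).Adj u v ↔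
    ∃ (e : Fin 6) (x y : LaaksoVertex m), (laaksoGraph m).Adj x y ∧
      u = copy m e x ∧ v = copy m e y := by
  rw [laaksoGraph, SimpleGraph.fromRel_adj]
  constructor
  · rintro ⟨-, ⟨e, x, y, h, hu, hv⟩ | ⟨e, x, y, h, hu, hv⟩⟩
    · exact ⟨e, x, y, h, hu, hv⟩
    · exact ⟨e, y, x, h.symm, hv, hu⟩
  · rintro ⟨e, x, y, h, rfl, rfl⟩
    exact ⟨fun hc => h.ne (copy_injective m e hc), Or.inl ⟨e, x, y, h, rfl, rfl⟩⟩

/-- The folding of the graph of index `m + 1` onto a copy in the layer `l`. -/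
def fold (m l : ℕ) : LaaksoVertex (m + 1) → LaaksoVertex m
  | Sum.inl false => source m
  | Sum.inl true => sink m
  | Sum.inr (Sum.inl j) => if depth j ≤ l then source m else sink m
  | Sum.inr (Sum.inr (e, v)) =>
      if layer e < l then source m else if layer e = l then Sum.inr v else sink m

theorem fold_copy (m l : ℕ) (hl : l < 4) (e : Fin 6) (x : LaaksoVertex m) :
    fold m l (copy m e x) =
      if layer e < l then source m else if layer e = l then x else sink m := by
  rcases x with (_ | _) | v
  · change fold m l (tail m e) = _
    interval_cases l <;> fin_cases e <;> rfl
  · change fold m l (head m e) = _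
    interval_cases l <;> fin_cases e <;> rfl
  · rfl

/-- No shortcut leaves the copy: `fold` is a left inverse of the inclusion, and both maps send each
edge to an edge or a point. -/
theorem dist_copy (m : ℕ) (e : Fin 6) (x y : LaaksoVertex m) :
    dist (copy m e x) (copy m e y) = dist x y / 4 := by
  have h : (laaksoGraph (m + 1)).dist (copy m e x) (copy m e y) = (laaksoGraph m).dist x y := by
    apply le_antisymm
    · exact SimpleGraph.dist_map_le_of_adj (laaksoGraph_connected m) (laaksoGraph_connected _)
        (copy m e) (fun a b hab => Or.inr (adj_succ_iff.mpr ⟨e, a, b, hab, rfl, rfl⟩)) x y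
    · have hl := layer_lt e
      have := SimpleGraph.dist_map_le_of_adj (laaksoGraph_connected (m + 1))
        (laaksoGraph_connected m) (fold m (layer e)) (by
          intro a b hab
          obtain ⟨e', a, b, h, rfl, rfl⟩ := adj_succ_iff.mp hab
          rw [fold_copy m _ hl, fold_copy m _ hl]
          split_ifs
          · exact Or.inl rfl
          · exact Or.inr h
          · exact Or.inl rfl) (copy m e x) (copy m e y)
      rw [fold_copy m _ hl, fold_copy m _ hl] at this
      simpa using this
  change ((laaksoGraph (m + 1)).dist _ _ : ℝ) / 4 ^ (m + 1) = ((laaksoGraph m).dist _ _ : ℝ) / 4 ^ m / 4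
  rw [h, pow_succ, div_div]

/-! ### Lower bounds on distances from Lipschitz potentials -/

/-- The height of the vertices other than the endpoints. -/
def innerHeight : (m : ℕ) → LaaksoInner m → ℤ
  | m + 1, Sum.inl j => depth j * 4 ^ m
  | m + 1, Sum.inr (e, v) => layer e * 4 ^ m + innerHeight m v

/-- The distance from the root, in multiples of the edge length. -/
def height (m : ℕ) : LaaksoVertex m → ℤ
  | Sum.inl false => 0
  | Sum.inl true => 4 ^ m
  | Sum.inr v => innerHeight m v

@[simp] theorem height_source (m : ℕ) : height m (source m) = 0 := rfl

@[simp] theorem height_sink (m : ℕ) : height m (sink m) = 4 ^ m := rfl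

theorem height_junction (m : ℕ) (j : Fin 4) :
    height (m + 1) (junction m j) = depth j * 4 ^ m := rfl

theorem height_copy (m : ℕ) (e : Fin 6) (x : LaaksoVertex m) :
    height (m + 1) (copy m e x) = layer e * 4 ^ m + height m x := by
  rcases x with (_ | _) | v
  · change height (m + 1) (tail m e) = layer e * 4 ^ m + height m (source m)
    rw [height_source]
    fin_cases e <;> simp [tail, height_junction, layer, depth]
  · change height (m + 1) (head m e) = layer e * 4 ^ m + height m (sink m)
    rw [height_sink]
    fin_cases e <;> simp [head, height_junction, layer, depth] <;> ring
  · rfl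

theorem abs_height_sub_le (m : ℕ) (x y : LaaksoVertex m) (h : (laaksoGraph m).Adj x y) :
    |height m x - height m y| ≤ 1 := by
  induction m with
  | zero =>
    rcases x with (_ | _) | x
    · rcases y with (_ | _) | y
      · simp
      · simp [height]
      · exact y.elim
    · rcases y with (_ | _) | y
      · simp [height]
      · simp
      · exact y.elim
    · exact x.elim
  | succ m ih =>
    obtain ⟨e, a, b, hab, rfl, rfl⟩ := adj_succ_iff.mp h
    rw [height_copy, height_copy]
    simpa using ih a b hab

theorem dist_source_sink (m : ℕ) : 1 ≤ dist (source m) (sink m) := by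
  have h := SimpleGraph.abs_sub_le_dist_of_adj (laaksoGraph_connected m) (height m)
    (abs_height_sub_le m) (source m) (sink m)
  rw [height_source, height_sink] at h
  simp only [zero_sub, abs_neg, abs_pow] at h
  have h' : (4 : ℝ) ^ m ≤ (laaksoGraph m).dist (source m) (sink m) := by exact_mod_cast h
  change 1 ≤ ((laaksoGraph m).dist _ _ : ℝ) / 4 ^ m
  rwa [one_le_div (by positivity)]

/-- A signed position along the cycle of the graph of index `m + 1`, which separates the gluing
points `1` and `2`. -/
def cyclePos (m : ℕ) : LaaksoVertex (m + 1) → ℤ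
  | Sum.inl _ => 0
  | Sum.inr (Sum.inl j) => ![0, 4 ^ m, -4 ^ m, 0] j
  | Sum.inr (Sum.inr (e, v)) =>
      (![0, 1, -1, -1, 1, 0] : Fin 6 → ℤ) e * height m (Sum.inr v) +
        (![0, 0, 0, 4 ^ m, -4 ^ m, 0] : Fin 6 → ℤ) e

theorem cyclePos_copy (m : ℕ) (e : Fin 6) (x : LaaksoVertex m) :
    cyclePos m (copy m e x) = (![0, 1, -1, -1, 1, 0] : Fin 6 → ℤ) e * height m x +
        (![0, 0, 0, 4 ^ m, -4 ^ m, 0] : Fin 6 → ℤ) e := by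
  have h0 : height m (Sum.inl false) = 0 := rfl
  have h1 : height m (Sum.inl true) = 4 ^ m := rfl
  rcases x with (_ | _) | v
  · change cyclePos m (tail m e) = _
    rw [h0]
    fin_cases e <;> simp [tail, source, junction, cyclePos]
  · change cyclePos m (head m e) = _
    rw [h1]
    fin_cases e <;> simp [head, sink, junction, cyclePos]
  · rfl

theorem dist_junction (m : ℕ) : 1 / 2 ≤ dist (junction m 1) (junction m 2) := by
  have h := SimpleGraph.abs_sub_le_dist_of_adj (laaksoGraph_connected (m + 1)) (cyclePos m) (by
    intro a b hab
    obtain ⟨e, a, b, h, rfl, rfl⟩ := adj_succ_iff.mp hab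
    have := abs_height_sub_le m a b h
    rw [cyclePos_copy, cyclePos_copy, add_sub_add_right_eq_sub, ← mul_sub, abs_mul]
    exact mul_le_one₀ (by fin_cases e <;> simp) (abs_nonneg _) this) (junction m 1) (junction m 2)
  have h1 : cyclePos m (junction m 1) - cyclePos m (junction m 2) = 2 * 4 ^ m := by
    simp [cyclePos, junction]; ring
  rw [h1, abs_of_nonneg (by positivity)] at h
  have h' : (2 : ℝ) * 4 ^ m ≤ (laaksoGraph (m + 1)).dist (junction m 1) (junction m 2) := by
    exact_mod_cast h
  change 1 / 2 ≤ ((laaksoGraph (m + 1)).dist _ _ : ℝ) / 4 ^ (m + 1)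
  rw [div_le_div_iff₀ (by norm_num) (by positivity), pow_succ]
  linarith

theorem dist_le_one_of_index_zero (x y : LaaksoVertex 0) : dist x y ≤ 1 := by
  change ((laaksoGraph 0).dist x y : ℝ) / 4 ^ 0 ≤ 1
  rw [pow_zero, div_one]
  by_cases h : x = y
  · simp [h]
  · have : (laaksoGraph 0).Adj x y := h
    rw [SimpleGraph.dist_eq_one_iff_adj.mpr this]; simp

/-! ### Number of vertices -/

theorem card_inner_le (m : ℕ) : Fintype.card (LaaksoInner m) + 2 ≤ 2 * 6 ^ m := by
  induction m with
  | zero =>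
    have : Fintype.card (LaaksoInner 0) = 0 := Fintype.card_empty
    omega
  | succ m ih =>
    have : Fintype.card (LaaksoInner (m + 1)) = 4 + 6 * Fintype.card (LaaksoInner m) := by
      change Fintype.card (Fin 4 ⊕ (Fin 6 × LaaksoInner m)) = _
      simp
    rw [this, pow_succ]
    omega

theorem card_eq (m : ℕ) : Fintype.card (LaaksoVertex m) = 2 + Fintype.card (LaaksoInner m) := by
  change Fintype.card (Bool ⊕ LaaksoInner m) = _
  simp

theorem log_card_nonneg (m : ℕ) : 0 ≤ Real.log (Fintype.card (LaaksoVertex m)) :=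
  Real.log_natCast_nonneg _

theorem log_card_le (m : ℕ) : Real.log (Fintype.card (LaaksoVertex m)) ≤ 2 * (m + 1) := by
  have h1 : Fintype.card (LaaksoVertex m) ≤ 6 ^ (m + 1) := by
    have := card_inner_le m
    rw [card_eq, pow_succ]
    omega
  have h2 : (0 : ℝ) < Fintype.card (LaaksoVertex m) := by
    rw [card_eq]; positivity
  have h6 : Real.log 6 ≤ 2 := by
    rw [Real.log_le_iff_le_exp (by norm_num)]
    have := Real.exp_one_gt_d9
    have h : Real.exp 2 = Real.exp 1 * Real.exp 1 := by rw [← Real.exp_add]; norm_num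
    rw [h]; nlinarith
  calc Real.log (Fintype.card (LaaksoVertex m)) ≤ Real.log (6 ^ (m + 1)) :=
        Real.log_le_log h2 (by exact_mod_cast h1)
    _ = (m + 1) * Real.log 6 := by rw [Real.log_pow]; push_cast; ring
    _ ≤ _ := by nlinarith

end LaaksoVertex

/-! ### Distortion of Laakso graphs in uniformly convex spaces -/

theorem ofReal_le_leastDistortion {N M : Type*} [MetricSpace N] [MetricSpace M] {c : ℝ}
    (h : ∀ D r : ℝ, 0 < D → 0 < r → ∀ f : N → M,
      (∀ x y, r * dist x y ≤ dist (f x) (f y)) → (∀ x y, dist (f x) (f y) ≤ D * r * dist x y) →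
      c ≤ D) :
    ENNReal.ofReal c ≤ leastDistortion N M := by
  refine le_iInf₂ fun D hD => ?_
  obtain ⟨hD, r, hr, f, hf⟩ := hD
  exact ENNReal.ofReal_le_ofReal (h D r hD hr f (fun x y => (hf x y).1) fun x y => (hf x y).2)

/-! ### Two-point convexity and induction over the levels -/

/-- The two-point form of uniform convexity of power type `p`. -/
def IsTwoPointConvex {X : Type*} [AddCommGroup X] [Module ℝ X] (p K : ℝ) (N : Seminorm ℝ X) :
    Prop :=
  ∀ x y : X, N ((1 / 2 : ℝ) • (x + y)) ^ p + K * N ((1 / 2 : ℝ) • (x - y)) ^ p ≤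
    (N x ^ p + N y ^ p) / 2

namespace IsTwoPointConvex

variable {X : Type*} [AddCommGroup X] [Module ℝ X] {p K : ℝ} {N : Seminorm ℝ X}

theorem midpoint_le (hN : IsTwoPointConvex p K N) (hK : 0 ≤ K) (x y : X) :
    N ((1 / 2 : ℝ) • (x + y)) ^ p ≤ (N x ^ p + N y ^ p) / 2 := by
  have := hN x y
  have h : 0 ≤ K * N ((1 / 2 : ℝ) • (x - y)) ^ p :=
    mul_nonneg hK (Real.rpow_nonneg (apply_nonneg _ _) _)
  linarith

/-- The two-point inequality is applied to each of the paths from `w` to `v` through `y` and through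
`z`. The two defect vectors average to `-(y - z)/2`, so convexity of `N ^ p` leaves the diagonal as
the gain. -/
theorem quadrilateral (hN : IsTwoPointConvex p K N) (hK : 0 ≤ K) (w y z v : X) :
    N ((1 / 2 : ℝ) • (v - w)) ^ p + K * N ((1 / 2 : ℝ) • (y - z)) ^ p ≤
      (N (y - w) ^ p + N (z - w) ^ p + N (v - y) ^ p + N (v - z) ^ p) / 4 := by
  have h1 := hN (v - y) (y - w)
  have h2 := hN (z - w) (v - z)
  have h3 := hN.midpoint_le hK ((1 / 2 : ℝ) • ((v - y) - (y - w)))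
    ((1 / 2 : ℝ) • ((z - w) - (v - z)))
  have e1 : (v - y) + (y - w) = v - w := by abel
  have e2 : (z - w) + (v - z) = v - w := by abel
  have e3 : (1 / 2 : ℝ) • ((v - y) - (y - w)) + (1 / 2 : ℝ) • ((z - w) - (v - z)) = -(y - z) := by
    module
  rw [e1] at h1
  rw [e2] at h2
  rw [e3, smul_neg, map_neg_eq_map] at h3
  nlinarith [mul_le_mul_of_nonneg_left h3 hK]

/-- A quarter of `t - s` is the mean of half the diagonal `v - w` and the midpoint of the two
pendant displacements. The resulting weights, `1/4` on each pendant copy and `1/8` on each cycle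
copy, sum to `1`. -/
theorem laakso_step (hN : IsTwoPointConvex p K N) (hK : 0 ≤ K) (s w y z v t : X) :
    N ((1 / 4 : ℝ) • (t - s)) ^ p + K / 2 * N ((1 / 2 : ℝ) • (y - z)) ^ p ≤
      (N (w - s) ^ p + N (t - v) ^ p +
        (N (y - w) ^ p + N (z - w) ^ p + N (v - y) ^ p + N (v - z) ^ p) / 2) / 4 := by
  have h1 := hN.quadrilateral hK w y z v
  have h2 := hN.midpoint_le hK (w - s) (t - v)
  have h3 := hN.midpoint_le hK ((1 / 2 : ℝ) • ((w - s) + (t - v))) ((1 / 2 : ℝ) • (v - w))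
  have e : (1 / 2 : ℝ) • ((1 / 2 : ℝ) • ((w - s) + (t - v)) + (1 / 2 : ℝ) • (v - w)) =
      (1 / 4 : ℝ) • (t - s) := by module
  rw [e] at h3
  linarith

-- Rescaling is built into the induction: a copy satisfies the hypotheses with `r / 4` and `M / 4`.
-- Because the weights of `laakso_step` sum to `1`, the gains of the six copies pass on
-- undiminished, and the new cycle adds one more.
open LaaksoVertex in
theorem laakso_endpoints (hN : IsTwoPointConvex p K N) (hK : 0 ≤ K) (hp : 0 < p) (m : ℕ) :
    ∀ (f : LaaksoVertex m → X) (r M : ℝ), 0 ≤ r → 0 ≤ M →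
      (∀ x y, r * dist x y ≤ N (f x - f y)) → (∀ x y, N (f x - f y) ≤ M * dist x y) →
      N (f (sink m) - f (source m)) ^ p + m * (K / 2) * r ^ p ≤ M ^ p := by
  induction m with
  | zero =>
    intro f r M hr hM h1 h2
    have h : N (f (sink 0) - f (source 0)) ≤ M :=
      (h2 _ _).trans (mul_le_of_le_one_right hM (dist_le_one_of_index_zero _ _))
    simpa using Real.rpow_le_rpow (apply_nonneg _ _) h hp.le
  | succ m ih =>
    intro f r M hr hM h1 h2
    have key (e : Fin 6) := ih (fun x => f (copy m e x)) (r / 4) (M / 4) (by positivity)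
      (by positivity)
      (fun x y => by
        refine le_trans (le_of_eq ?_) (h1 _ _)
        rw [dist_copy]; ring)
      (fun x y => by
        refine (h2 _ _).trans (le_of_eq ?_)
        rw [dist_copy]; ring)
    have h := hN.laakso_step hK (f (source (m + 1))) (f (junction m 0)) (f (junction m 1))
      (f (junction m 2)) (f (junction m 3)) (f (sink (m + 1)))
    have k0 : N (f (junction m 0) - f (source (m + 1))) ^ p + _ ≤ _ := key 0
    have k1 : N (f (junction m 1) - f (junction m 0)) ^ p + _ ≤ _ := key 1
    have k2 : N (f (junction m 2) - f (junction m 0)) ^ p + _ ≤ _ := key 2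
    have k3 : N (f (junction m 3) - f (junction m 1)) ^ p + _ ≤ _ := key 3
    have k4 : N (f (junction m 3) - f (junction m 2)) ^ p + _ ≤ _ := key 4
    have k5 : N (f (sink (m + 1)) - f (junction m 3)) ^ p + _ ≤ _ := key 5
    -- The junctions are at distance at least `1/2`, and halving the vector gives `r / 4`. The
    -- factor `4 ^ p` of the rescaling turns this into a gain in `r ^ p` independent of the level.
    have hj : r / 4 ≤ N ((1 / 2 : ℝ) • (f (junction m 1) - f (junction m 2))) := by
      rw [map_smul_eq_mul, Real.norm_of_nonneg (by norm_num)]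
      have := h1 (junction m 1) (junction m 2)
      nlinarith [dist_junction m]
    have hj' : K / 2 * (r / 4) ^ p ≤
        K / 2 * N ((1 / 2 : ℝ) • (f (junction m 1) - f (junction m 2))) ^ p :=
      mul_le_mul_of_nonneg_left (Real.rpow_le_rpow (by positivity) hj hp.le) (by positivity)
    have h4 : N ((1 / 4 : ℝ) • (f (sink (m + 1)) - f (source (m + 1)))) ^ p =
        (N (f (sink (m + 1)) - f (source (m + 1)))) ^ p / 4 ^ p := by
      rw [map_smul_eq_mul, Real.norm_of_nonneg (by norm_num), ← Real.div_rpow (apply_nonneg _ _)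
        (by norm_num)]
      congr 1; ring
    have h4p : (0 : ℝ) < 4 ^ p := by positivity
    rw [Real.div_rpow hr (by norm_num)] at k0 k1 k2 k3 k4 k5 hj'
    rw [Real.div_rpow hM (by norm_num)] at k0 k1 k2 k3 k4 k5
    have hfin : (N (f (sink (m + 1)) - f (source (m + 1)))) ^ p / 4 ^ p +
        (m + 1) * (K / 2) * (r ^ p / 4 ^ p) ≤ M ^ p / 4 ^ p := by
      rw [← h4]; linarith
    have := mul_le_mul_of_nonneg_right hfin h4p.le
    rw [add_mul, mul_assoc, div_mul_cancel₀ _ h4p.ne', div_mul_cancel₀ _ h4p.ne',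
      div_mul_cancel₀ _ h4p.ne'] at this
    push_cast
    exact this

theorem le_distortion_rpow (hN : IsTwoPointConvex p K N) (hK : 0 ≤ K) (hp : 0 < p) (m : ℕ)
    (f : LaaksoVertex m → X) {r D : ℝ} (hr : 0 < r) (hD : 0 ≤ D)
    (h1 : ∀ x y, r * dist x y ≤ N (f x - f y)) (h2 : ∀ x y, N (f x - f y) ≤ D * r * dist x y) :
    1 + m * (K / 2) ≤ D ^ p := by
  have h := hN.laakso_endpoints hK hp m f r (D * r) hr.le (by positivity) h1 h2
  have h3 : r ≤ N (f (LaaksoVertex.sink m) - f (LaaksoVertex.source m)) := by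
    refine le_trans ?_ (h1 _ _)
    rw [dist_comm]
    exact le_mul_of_one_le_right hr.le (LaaksoVertex.dist_source_sink m)
  have h4 := Real.rpow_le_rpow hr.le h3 hp.le
  rw [Real.mul_rpow hD hr.le] at h
  have : (1 + m * (K / 2)) * r ^ p ≤ D ^ p * r ^ p := by linarith
  exact le_of_mul_le_mul_right this (by positivity)

end IsTwoPointConvex

/-- This converts a lower bound on `D ^ p` that is linear in `m + 1` into one on `D` by the
logarithm, through `log_card_le`. -/
theorem LaaksoVertex.mul_log_card_rpow_le {p a D : ℝ} (hp : 0 < p) (ha : 0 ≤ a) (hD : 0 ≤ D)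
    (m : ℕ) (h : 2 * (m + 1) * a ^ p ≤ D ^ p) :
    a * Real.log (Fintype.card (LaaksoVertex m)) ^ (1 / p) ≤ D := by
  rw [← Real.rpow_le_rpow_iff (mul_nonneg ha (Real.rpow_nonneg (log_card_nonneg m) _)) hD hp,
    Real.mul_rpow ha (Real.rpow_nonneg (log_card_nonneg m) _),
    ← Real.rpow_mul (log_card_nonneg m), one_div_mul_cancel hp.ne', Real.rpow_one]
  refine le_trans ?_ h
  rw [mul_comm]
  exact mul_le_mul_of_nonneg_right (log_card_le m) (by positivity)

/-! ### Clarkson's inequality and modulus of convexity -/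

/-- The parallelogram identity for the squares, between superadditivity and convexity of `t ↦ t ^ (p
/ 2)`, which need `p / 2 ≥ 1`. -/
theorem Real.clarkson {p : ℝ} (hp : 2 ≤ p) (a b : ℝ) :
    |(1 / 2) * (a + b)| ^ p + |(1 / 2) * (a - b)| ^ p ≤ (|a| ^ p + |b| ^ p) / 2 := by
  have hq : 1 ≤ p / 2 := by linarith
  have e (x : ℝ) : |x| ^ p = (x ^ 2) ^ (p / 2) := by
    rw [← sq_abs, ← Real.rpow_natCast, ← Real.rpow_mul (abs_nonneg x)]
    congr 1; push_cast; ring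
  simp only [e]
  have h1 := Real.add_rpow_le_rpow_add (sq_nonneg ((1 / 2) * (a + b)))
    (sq_nonneg ((1 / 2) * (a - b))) hq
  have h2 := (convexOn_rpow hq).2 (Set.mem_Ici.mpr (sq_nonneg a)) (Set.mem_Ici.mpr (sq_nonneg b))
    (by norm_num : (0 : ℝ) ≤ 1 / 2) (by norm_num : (0 : ℝ) ≤ 1 / 2) (by norm_num)
  simp only [smul_eq_mul] at h2
  have e2 : (1 / 2 * (a + b)) ^ 2 + (1 / 2 * (a - b)) ^ 2 = 1 / 2 * a ^ 2 + 1 / 2 * b ^ 2 := by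
    ring
  rw [e2] at h1
  linarith

/-- Clarkson's inequality. -/
theorem MeasureTheory.Lp.isTwoPointConvex {p : ℝ} (hp : 2 ≤ p) [Fact (1 ≤ ENNReal.ofReal p)]
    {S : Type*} [MeasurableSpace S] (μ : MeasureTheory.Measure S) :
    IsTwoPointConvex p 1 (normSeminorm ℝ (MeasureTheory.Lp ℝ (ENNReal.ofReal p) μ)) := by
  intro f g
  simp only [coe_normSeminorm, one_mul]
  have hp0 : 0 < p := by linarith
  have hE (f : MeasureTheory.Lp ℝ (ENNReal.ofReal p) μ) :
      ENNReal.ofReal (‖f‖ ^ p) = ∫⁻ s, ENNReal.ofReal (|f s| ^ p) ∂μ := by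
    rw [← ENNReal.ofReal_rpow_of_nonneg (norm_nonneg _) hp0.le, ofReal_norm,
      MeasureTheory.Lp.enorm_def, MeasureTheory.eLpNorm_eq_lintegral_rpow_enorm_toReal (by simpa using hp0)
      (by simp), ENNReal.toReal_ofReal hp0.le, ← ENNReal.rpow_mul, one_div_mul_cancel hp0.ne',
      ENNReal.rpow_one]
    refine MeasureTheory.lintegral_congr fun s => ?_
    rw [← ENNReal.ofReal_rpow_of_nonneg (abs_nonneg _) hp0.le, Real.enorm_eq_ofReal_abs]
  have hm (f : MeasureTheory.Lp ℝ (ENNReal.ofReal p) μ) :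
      AEMeasurable (fun s => ENNReal.ofReal (|f s| ^ p)) μ :=
    (((MeasureTheory.Lp.aestronglyMeasurable f).aemeasurable.abs).pow_const p).ennreal_ofReal
  have nn (f : MeasureTheory.Lp ℝ (ENNReal.ofReal p) μ) : 0 ≤ ‖f‖ ^ p := by positivity
  rw [← ENNReal.ofReal_le_ofReal_iff (by positivity), ENNReal.ofReal_add (nn _) (nn _),
    add_div, ENNReal.ofReal_add (by positivity) (by positivity),
    div_eq_inv_mul (‖f‖ ^ p), div_eq_inv_mul (‖g‖ ^ p), ENNReal.ofReal_mul (by positivity),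
    ENNReal.ofReal_mul (by positivity), hE, hE, hE, hE,
    ← MeasureTheory.lintegral_add_left' (hm _),
    ← MeasureTheory.lintegral_const_mul'' _ (hm _), ← MeasureTheory.lintegral_const_mul'' _ (hm _),
    ← MeasureTheory.lintegral_add_left' ((hm _).const_mul _)]
  apply MeasureTheory.lintegral_mono_ae
  filter_upwards [MeasureTheory.Lp.coeFn_smul (1 / 2 : ℝ) (f + g), MeasureTheory.Lp.coeFn_add f g,
    MeasureTheory.Lp.coeFn_smul (1 / 2 : ℝ) (f - g), MeasureTheory.Lp.coeFn_sub f g]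
    with s h1 h2 h3 h4
  rw [h1, h3, Pi.smul_apply, Pi.smul_apply, h2, h4, Pi.add_apply, Pi.sub_apply, smul_eq_mul,
    smul_eq_mul, ← ENNReal.ofReal_add (by positivity) (by positivity),
    ← ENNReal.ofReal_mul (by positivity), ← ENNReal.ofReal_mul (by positivity),
    ← ENNReal.ofReal_add (by positivity) (by positivity)]
  apply ENNReal.ofReal_le_ofReal
  have := Real.clarkson hp (f s) (g s)
  linarith

/-- A modulus of convexity of power type `p` yields the two-point inequality. -/
theorem exists_isTwoPointConvex {X : Type*} [AddCommGroup X] [Module ℝ X] {p K : ℝ} (hp : 2 ≤ p)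
    (hK : 0 < K) (N : Seminorm ℝ X)
    (hN : ∀ x y, N x = 1 → N y = 1 → N ((1 / 2 : ℝ) • (x + y)) ≤ 1 - K * N (x - y) ^ p) :
    ∃ K' : ℝ, 0 < K' ∧ IsTwoPointConvex p K' N := by
  have hp0 : 0 < p := by linarith
  set A : ℝ := (1 / 2) ^ p with hA
  set B : ℝ := (1 / 2) ^ (p - 1) * (1 / 3) * K with hB
  have hA0 : 0 < A := by positivity
  have hB0 : 0 < B := by positivity
  refine ⟨min A B, lt_min hA0 hB0, ?_⟩
  -- the normalized case
  have main : ∀ x y : X, N x = 1 → N y ≤ 1 →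
      N ((1 / 2 : ℝ) • (x + y)) ^ p + min A B * N ((1 / 2 : ℝ) • (x - y)) ^ p ≤
        (1 + N y ^ p) / 2 := by
    intro x y hx hy
    set s := N y with hs
    have hs0 : 0 ≤ s := apply_nonneg _ _
    have half (z : X) : N ((1 / 2 : ℝ) • z) = N z / 2 := by
      rw [map_smul_eq_mul, Real.norm_of_nonneg (by norm_num)]; ring
    set d := N (x - y) with hd
    have hd0 : 0 ≤ d := apply_nonneg _ _
    have hclark := Real.clarkson hp 1 s
    rw [abs_of_nonneg (by positivity), abs_of_nonneg (by linarith : 0 ≤ 1 / 2 * (1 - s)),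
      abs_one, Real.one_rpow, abs_of_nonneg hs0] at hclark
    have hd2 : N ((1 / 2 : ℝ) • (x - y)) = d / 2 := half _
    rw [hd2]
    -- If the distance `d` is mostly due to the difference of norms `1 - s`, the scalar inequality
    -- `hclark` supplies the whole gain. Otherwise the directions differ and the modulus of
    -- convexity is used.
    by_cases hcase : d ≤ 2 * (1 - s)
    · have h1 : N ((1 / 2 : ℝ) • (x + y)) ≤ 1 / 2 * (1 + s) := by
        rw [half]
        have := map_add_le_add N x y
        linarith
      have h2 := Real.rpow_le_rpow (apply_nonneg _ _) h1 hp0.le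
      have h3 : min A B * (d / 2) ^ p ≤ (1 / 2 * (1 - s)) ^ p := by
        calc min A B * (d / 2) ^ p ≤ A * (d / 2) ^ p :=
              mul_le_mul_of_nonneg_right (min_le_left _ _) (by positivity)
          _ = (1 / 2 * (d / 2)) ^ p := by rw [hA, Real.mul_rpow (by norm_num) (by positivity)]
          _ ≤ _ := Real.rpow_le_rpow (by positivity) (by linarith) hp0.le
      linarith
    · push Not at hcase
      have hds : d ≤ 1 + s := by
        have := map_sub_le_add N x y
        linarith
      -- From `2 * (1 - s) < d ≤ 1 + s`; this makes normalizing `y` harmless.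
      have hs3 : 1 / 3 ≤ s := by linarith
      have hspos : 0 < s := by linarith
      have hy1 : N (s⁻¹ • y) = 1 := by
        rw [map_smul_eq_mul, Real.norm_of_nonneg (by positivity), ← hs, inv_mul_cancel₀ hspos.ne']
      have h1 := hN x (s⁻¹ • y) hx hy1
      -- Normalizing moves `y` by only `1 - s < d / 2`.
      have h2 : d / 2 ≤ N (x - s⁻¹ • y) := by
        have e : x - y = (x - s⁻¹ • y) + (s⁻¹ - 1) • y := by module
        have h3 : N ((s⁻¹ - 1) • y) = 1 - s := by
          rw [map_smul_eq_mul, Real.norm_of_nonneg (by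
            have := (one_le_inv₀ hspos).mpr hy
            linarith), ← hs, sub_mul, inv_mul_cancel₀ hspos.ne', one_mul]
        have := map_add_le_add N (x - s⁻¹ • y) ((s⁻¹ - 1) • y)
        rw [← e, h3] at this
        linarith
      have h3 : N ((1 / 2 : ℝ) • (x + y)) ≤ 1 / 2 * (1 + s) - s * (K * (d / 2) ^ p) := by
        -- The midpoint splits into `s` times the midpoint of two unit vectors, where the modulus
        -- applies, and a remainder along `x` that costs exactly `(1 - s) / 2`.
        have e : (1 / 2 : ℝ) • (x + y) =
            s • ((1 / 2 : ℝ) • (x + s⁻¹ • y)) + ((1 - s) / 2) • x := by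
          have : s • s⁻¹ • y = y := by rw [smul_smul, mul_inv_cancel₀ hspos.ne', one_smul]
          rw [smul_comm s, smul_add s, this]
          module
        rw [e]
        refine (map_add_le_add N _ _).trans ?_
        rw [map_smul_eq_mul N s, map_smul_eq_mul N ((1 - s) / 2), Real.norm_of_nonneg hs0,
          Real.norm_of_nonneg (by linarith), hx]
        have h4 : K * (d / 2) ^ p ≤ K * N (x - s⁻¹ • y) ^ p :=
          mul_le_mul_of_nonneg_left (Real.rpow_le_rpow (by positivity) h2 hp0.le) hK.le
        have := mul_le_mul_of_nonneg_left (h1.trans (sub_le_sub_left h4 1)) hs0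
        linarith
      set u := 1 / 2 * (1 + s) with hu
      set n := N ((1 / 2 : ℝ) • (x + y)) with hn
      have hn0 : 0 ≤ n := apply_nonneg _ _
      have hu0 : 0 < u := by positivity
      set v := s * (K * (d / 2) ^ p) with hv
      have hv0 : 0 ≤ v := by positivity
      have hpow (z : ℝ) (hz : 0 ≤ z) : z ^ p = z ^ (p - 1) * z := by
        rw [← Real.rpow_add_one' hz (by linarith), sub_add_cancel]
      -- From `n ≤ u - v`: one factor of `n ^ p` is bounded by `u - v`, the other `p - 1` by `u`.
      -- The bound `u ≥ 1/2` then accounts for the power of `1/2` in `B`.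
      have h5 : n ^ p ≤ u ^ p - u ^ (p - 1) * v := by
        rw [hpow n hn0, hpow u hu0.le, ← mul_sub]
        exact mul_le_mul (Real.rpow_le_rpow hn0 (by linarith) (by linarith)) h3 hn0
          (by positivity)
      have h6 : min A B * (d / 2) ^ p ≤ u ^ (p - 1) * v := by
        calc min A B * (d / 2) ^ p ≤ B * (d / 2) ^ p :=
              mul_le_mul_of_nonneg_right (min_le_right _ _) (by positivity)
          _ = (1 / 2) ^ (p - 1) * (1 / 3 * (K * (d / 2) ^ p)) := by rw [hB]; ring
          _ ≤ _ := by
            refine mul_le_mul ?_ ?_ (by positivity) (by positivity)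
            · exact Real.rpow_le_rpow (by norm_num) (by linarith) (by linarith)
            · exact mul_le_mul_of_nonneg_right hs3 (by positivity)
      have h7 : 0 ≤ (1 / 2 * (1 - s)) ^ p := Real.rpow_nonneg (by linarith) _
      linarith
  have scaled : ∀ x y : X, N y ≤ N x →
      N ((1 / 2 : ℝ) • (x + y)) ^ p + min A B * N ((1 / 2 : ℝ) • (x - y)) ^ p ≤
        (N x ^ p + N y ^ p) / 2 := by
    intro x y hxy
    rcases (apply_nonneg N x).eq_or_lt with h0 | h0
    · have hy : N y = 0 := le_antisymm (by rw [h0]; exact hxy) (apply_nonneg _ _)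
      have h1 : N ((1 / 2 : ℝ) • (x + y)) = 0 := by
        refine le_antisymm ?_ (apply_nonneg _ _)
        rw [map_smul_eq_mul]
        have := map_add_le_add N x y
        rw [← h0, hy, add_zero] at this
        exact mul_nonpos_of_nonneg_of_nonpos (norm_nonneg _) this
      have h2 : N ((1 / 2 : ℝ) • (x - y)) = 0 := by
        refine le_antisymm ?_ (apply_nonneg _ _)
        rw [map_smul_eq_mul]
        have := map_sub_le_add N x y
        rw [← h0, hy, add_zero] at this
        exact mul_nonpos_of_nonneg_of_nonpos (norm_nonneg _) this
      rw [h1, h2, ← h0, hy, Real.zero_rpow hp0.ne']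
      simp
    · set c := N x with hc
      have hsc (z : X) : N (c⁻¹ • z) = N z / c := by
        rw [map_smul_eq_mul, Real.norm_of_nonneg (by positivity), inv_mul_eq_div]
      have h := main (c⁻¹ • x) (c⁻¹ • y) (by rw [hsc, ← hc, div_self h0.ne'])
        (by rw [hsc, div_le_one h0]; exact hxy)
      rw [← smul_add, ← smul_sub, smul_comm _ c⁻¹, smul_comm _ c⁻¹, hsc, hsc, hsc,
        Real.div_rpow (apply_nonneg _ _) h0.le, Real.div_rpow (apply_nonneg _ _) h0.le,
        Real.div_rpow (apply_nonneg _ _) h0.le] at h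
      have hcp : 0 < c ^ p := by positivity
      have := mul_le_mul_of_nonneg_right h hcp.le
      field_simp at this
      linarith
  intro x y
  rcases le_total (N y) (N x) with h | h
  · exact scaled x y h
  · have := scaled y x h
    rw [add_comm y x, ← neg_sub x y, smul_neg, map_neg_eq_map] at this
    linarith

theorem exists_le_leastDistortion_of_isPConvex {p : ℝ} (hp : 2 ≤ p) {X : Type*}
    [NormedAddCommGroup X] [NormedSpace ℝ X] (hX : IsPConvex p X) : ∃ c : ℝ, 0 < c ∧ ∀ m : ℕ,
      ENNReal.ofReal (c * Real.log (Fintype.card (LaaksoVertex m)) ^ (1 / p)) ≤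
        leastDistortion (LaaksoVertex m) X := by
  have hp0 : 0 < p := by linarith
  obtain ⟨N, a, b, K, ha, hb, hK, hab, hN⟩ := hX
  obtain ⟨L, hL, hconv⟩ := exists_isTwoPointConvex hp hK N hN
  -- Chosen so that `2 * (m + 1) * k ≤ 1 + m * (L / 2)` for all `m`, including `m = 0`.
  set k := min 1 (L / 2) / 2 with hk
  have hk0 : 0 < k := by
    have : 0 < min 1 (L / 2) := lt_min one_pos (by positivity)
    positivity
  have hpow : ((k ^ (1 / p)) : ℝ) ^ p = k := by
    rw [← Real.rpow_mul hk0.le, one_div_mul_cancel hp0.ne', Real.rpow_one]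
  refine ⟨a / b * k ^ (1 / p), by positivity, fun m => ?_⟩
  refine ofReal_le_leastDistortion fun D r hD hr f h1 h2 => ?_
  have h := hconv.le_distortion_rpow hL.le hp0 m f (r := a * r) (D := b / a * D) (by positivity)
    (by positivity)
    (fun x y => by
      refine le_trans ?_ (hab _).1
      rw [← dist_eq_norm, mul_assoc]
      exact mul_le_mul_of_nonneg_left (h1 x y) ha.le)
    (fun x y => by
      refine (hab _).2.trans ?_
      rw [← dist_eq_norm]
      refine (mul_le_mul_of_nonneg_left (h2 x y) hb.le).trans (le_of_eq ?_)
      field_simp)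
  have h' := LaaksoVertex.mul_log_card_rpow_le (p := p) (a := k ^ (1 / p)) (D := b / a * D) hp0
    (by positivity) (by positivity) m (by
      rw [hpow]
      refine le_trans ?_ h
      have e1 : min 1 (L / 2) ≤ 1 := min_le_left _ _
      have e2 : min 1 (L / 2) ≤ L / 2 := min_le_right _ _
      have e3 : (m : ℝ) * min 1 (L / 2) ≤ m * (L / 2) := mul_le_mul_of_nonneg_left e2 (by positivity)
      have e4 : 2 * ((m : ℝ) + 1) * k = m * min 1 (L / 2) + min 1 (L / 2) := by rw [hk]; ring
      linarith)
  have := mul_le_mul_of_nonneg_left h' (by positivity : 0 ≤ a / b)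
  rw [← mul_assoc] at this
  refine this.trans (le_of_eq ?_)
  field_simp

theorem Real.rpow_le_sq_of_le_one {a p : ℝ} (ha : 0 < a) (ha1 : a ≤ 1) (hp : 2 ≤ p) :
    a ^ p ≤ a ^ 2 := by
  rw [← Real.rpow_two]
  exact Real.rpow_le_rpow_of_exponent_ge ha ha1 hp

theorem le_leastDistortion_Lp {p : ℝ} (hp : 2 ≤ p) [Fact (1 ≤ ENNReal.ofReal p)]
    {S : Type*} [MeasurableSpace S] (μ : MeasureTheory.Measure S) (m : ℕ) :
    ENNReal.ofReal (1 / 2 * Real.log (Fintype.card (LaaksoVertex m)) ^ (1 / p)) ≤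
      leastDistortion (LaaksoVertex m) (MeasureTheory.Lp ℝ (ENNReal.ofReal p) μ) := by
  refine ofReal_le_leastDistortion fun D r hD hr f h1 h2 => ?_
  have hp0 : 0 < p := by linarith
  refine LaaksoVertex.mul_log_card_rpow_le hp0 (by norm_num) hD.le m ?_
  have h := (MeasureTheory.Lp.isTwoPointConvex hp μ).le_distortion_rpow zero_le_one hp0 m f hr
    hD.le (fun x y => by simpa [dist_eq_norm] using h1 x y)
    (fun x y => by simpa [dist_eq_norm] using h2 x y)
  -- As `(1/2) ^ p ≤ 1/4`, it is enough that `(m + 1) / 2 ≤ 1 + m / 2`.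
  have h3 := Real.rpow_le_sq_of_le_one (a := 1 / 2) (by norm_num) (by norm_num) hp
  have h4 := mul_le_mul_of_nonneg_left h3 (by positivity : 0 ≤ 2 * ((m : ℝ) + 1))
  linarith

/-! ### Walks through the Laakso graphs -/

namespace LaaksoVertex

/-- The position after `n` steps of a walk from the root to the opposite endpoint, which stays there
after `4 ^ m` steps. The bit `b l` selects one of the two branches in all copies of the graph of
index `l + 1`. -/
def walk : (m : ℕ) → ℕ → (ℕ → Bool) → LaaksoVertex m
  | 0, n, _ => if n = 0 then source 0 else sink 0
  | m + 1, n, b =>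
      if n ≤ 4 ^ m then copy m 0 (walk m n b)
      else if n ≤ 2 * 4 ^ m then copy m (if b m then 1 else 2) (walk m (n - 4 ^ m) b)
      else if n ≤ 3 * 4 ^ m then copy m (if b m then 3 else 4) (walk m (n - 2 * 4 ^ m) b)
      else copy m 5 (walk m (n - 3 * 4 ^ m) b)

theorem walk_zero (m : ℕ) (b : ℕ → Bool) : walk m 0 b = source m := by
  induction m with
  | zero => rfl
  | succ m ih => rw [walk, if_pos (Nat.zero_le _), ih]; rfl

theorem walk_of_le (m : ℕ) {n : ℕ} (b : ℕ → Bool) (h : 4 ^ m ≤ n) : walk m n b = sink m := by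
  induction m generalizing n with
  | zero => rw [walk, if_neg (by simp at h; omega)]
  | succ m ih =>
    have := Nat.pow_pos (n := m) (show 0 < 4 by norm_num)
    rw [pow_succ] at h
    rw [walk, if_neg (by omega), if_neg (by omega), if_neg (by omega), ih (by omega)]
    rfl

theorem walk_succ_first {m n : ℕ} (b : ℕ → Bool) (h : n ≤ 4 ^ m) :
    walk (m + 1) n b = copy m 0 (walk m n b) := by
  rw [walk, if_pos h]

theorem walk_succ_second {m n : ℕ} (b : ℕ → Bool) (h : n ≤ 4 ^ m) :
    walk (m + 1) (4 ^ m + n) b = copy m (if b m then 1 else 2) (walk m n b) := by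
  -- `walk` assigns a gluing time to the earlier copy; at `n = 0` both descriptions give the same
  -- glued vertex.
  rcases Nat.eq_zero_or_pos n with rfl | hn
  · rw [add_zero, walk_succ_first b le_rfl, walk_of_le m b le_rfl, walk_zero]
    split_ifs <;> rfl
  · rw [walk, if_neg (by omega), if_pos (by omega), Nat.add_sub_cancel_left]

theorem walk_succ_third {m n : ℕ} (b : ℕ → Bool) (h : n ≤ 4 ^ m) :
    walk (m + 1) (2 * 4 ^ m + n) b = copy m (if b m then 3 else 4) (walk m n b) := by
  rcases Nat.eq_zero_or_pos n with rfl | hn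
  · rw [add_zero, two_mul, walk_succ_second b le_rfl, walk_of_le m b le_rfl, walk_zero]
    split_ifs <;> rfl
  · rw [walk, if_neg (by omega), if_neg (by omega), if_pos (by omega), Nat.add_sub_cancel_left]

theorem walk_succ_fourth (m n : ℕ) (b : ℕ → Bool) :
    walk (m + 1) (3 * 4 ^ m + n) b = copy m 5 (walk m n b) := by
  rcases Nat.eq_zero_or_pos n with rfl | hn
  · have h : 3 * 4 ^ m + 0 = 2 * 4 ^ m + 4 ^ m := by omega
    rw [h, walk_succ_third b le_rfl, walk_of_le m b le_rfl, walk_zero]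
    split_ifs <;> rfl
  · rw [walk, if_neg (by omega), if_neg (by omega), if_neg (by omega), Nat.add_sub_cancel_left]

theorem exists_quarter (m n : ℕ) : ∃ q k, n = q * 4 ^ m + k ∧ q ≤ 3 ∧ (q < 3 → k < 4 ^ m) := by
  by_cases h1 : n < 4 ^ m
  · exact ⟨0, n, by omega, by omega, fun _ => h1⟩
  by_cases h2 : n < 2 * 4 ^ m
  · exact ⟨1, n - 4 ^ m, by omega, by omega, fun _ => by omega⟩
  by_cases h3 : n < 3 * 4 ^ m
  · exact ⟨2, n - 2 * 4 ^ m, by omega, by omega, fun _ => by omega⟩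
  · exact ⟨3, n - 3 * 4 ^ m, by omega, by omega, fun h => by omega⟩

theorem mul_pow_add_mod {m l : ℕ} (h : l < m) (q k : ℕ) :
    (q * 4 ^ m + k) % 4 ^ (l + 1) = k % 4 ^ (l + 1) := by
  obtain ⟨c, hc⟩ := pow_dvd_pow 4 h
  rw [hc, mul_left_comm, Nat.mul_add_mod]

/-- Consecutive positions of the walk are at distance at most one edge, even if the branch `l` is
chosen anew at the times when the walk is at a fork of level `l`. -/
theorem dist_walk_succ_le (m n : ℕ) (b b' : ℕ → Bool)
    (h : ∀ l, l < m → n % 4 ^ (l + 1) ≠ 4 ^ l → b' l = b l) :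
    dist (walk m (n + 1) b') (walk m n b) ≤ 1 / 4 ^ m := by
  induction m generalizing n with
  | zero => simpa using dist_le_one_of_index_zero _ _
  | succ m ih =>
    obtain ⟨q, k, rfl, hq, hk⟩ := exists_quarter m n
    have hrec := ih k fun l hl hne => h l (hl.trans (Nat.lt_succ_self m)) (by
      rwa [mul_pow_add_mod hl])
    have hcopy (e : Fin 6) :
        dist (copy m e (walk m (k + 1) b')) (copy m e (walk m k b)) ≤ 1 / 4 ^ (m + 1) := by
      rw [dist_copy, pow_succ, ← div_div]
      linarith
    have hbit : q ≠ 3 → q ≠ 0 → 0 < k ∨ q = 2 → b' m = b m := by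
      intro h3 h0 hk0
      refine h m (Nat.lt_succ_self m) ?_
      have hk1 := hk (by omega)
      rw [Nat.mod_eq_of_lt (by rw [pow_succ]; interval_cases q <;> omega)]
      interval_cases q <;> omega
    rw [add_assoc]
    interval_cases q
    · rw [zero_mul, zero_add, zero_add, walk_succ_first _ (hk (by omega)),
        walk_succ_first _ (hk (by omega)).le]
      exact hcopy 0
    · rw [one_mul, walk_succ_second _ (hk (by omega)), walk_succ_second _ (hk (by omega)).le]
      -- At `k = 0` the walk is at the fork of level `m`, the only time when the bit `m` may change;
      -- copies `1` and `2` share their root there.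
      rcases Nat.eq_zero_or_pos k with rfl | hk0
      · have : copy m (if b m then 1 else 2) (walk m 0 b) =
            copy m (if b' m then 1 else 2) (walk m 0 b) := by
          rw [walk_zero]
          split_ifs <;> rfl
        rw [this]
        exact hcopy _
      · rw [hbit (by omega) (by omega) (Or.inl hk0)]
        exact hcopy _
    · rw [walk_succ_third _ (hk (by omega)), walk_succ_third _ (hk (by omega)).le,
        hbit (by omega) (by omega) (Or.inr rfl)]
      exact hcopy _
    · rw [walk_succ_fourth, walk_succ_fourth]
      exact hcopy _

theorem dist_walk_add_le (m n k : ℕ) (b : ℕ → Bool) :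
    dist (walk m (n + k) b) (walk m n b) ≤ k / 4 ^ m := by
  induction k with
  | zero => simp
  | succ k ih =>
    have h1 := dist_walk_succ_le m (n + k) b b fun _ _ _ => rfl
    have h2 := dist_triangle (walk m (n + (k + 1)) b) (walk m (n + k) b) (walk m n b)
    push_cast
    rw [add_div]
    exact h2.trans (by rw [← add_assoc]; linarith)

/-- Two walks that choose different branches at the last fork of level `i` are far apart in the
second half of the way from that fork to the middle of the branches. -/
theorem le_dist_walk (m i n : ℕ) (b b' : ℕ → Bool) (hi : i < m) (hn : n < 4 ^ m)
    (h1 : 3 * 4 ^ i ≤ 2 * (n % 4 ^ (i + 1))) (h2 : n % 4 ^ (i + 1) ≤ 2 * 4 ^ i)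
    (hne : b i ≠ b' i) (heq : ∀ l, i < l → b l = b' l) :
    (4 : ℝ) ^ i / 4 ^ m ≤ dist (walk m n b) (walk m n b') := by
  induction m generalizing n with
  | zero => omega
  | succ m ih =>
    rcases (Nat.lt_succ_iff.mp hi).eq_or_lt with rfl | him
    · rw [Nat.mod_eq_of_lt hn] at h1 h2
      obtain ⟨u, rfl⟩ : ∃ u, n = 4 ^ i + u := ⟨n - 4 ^ i, by omega⟩
      obtain ⟨v, hv⟩ : ∃ v, 4 ^ i = u + v := ⟨4 ^ i - u, by omega⟩
      have hu : u ≤ 4 ^ i := by omega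
      rw [walk_succ_second _ hu, walk_succ_second _ hu]
      -- The bits below `i` may differ arbitrarily: every continuation reaches the middle of its
      -- branch in `v` more steps.
      have hclose (e : Fin 6) (b : ℕ → Bool) : dist (copy i e (sink i)) (copy i e (walk i u b)) ≤
          v / 4 ^ (i + 1) := by
        have := dist_walk_add_le i u v b
        rw [← hv, walk_of_le i b le_rfl] at this
        rw [dist_copy, pow_succ, ← div_div]
        linarith
      have hvle : (4 * v : ℝ) ≤ 2 * 4 ^ i := by
        have : 4 * v ≤ 2 * 4 ^ i := by omega
        exact_mod_cast this
      -- The middles are `1/2` apart and each walk is within `1/8` of its own, since `v ≤ 4 ^ i /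
      -- 2`; this leaves `1/4`.
      have hgoal : (4 : ℝ) ^ i / 4 ^ (i + 1) ≤ 1 / 2 - 2 * (v / 4 ^ (i + 1)) := by
        have h4 : (0 : ℝ) < 4 ^ i := by positivity
        rw [pow_succ]
        field_simp
        linarith
      have hsep (x y : LaaksoVertex i) (hx : dist (junction i 1) (copy i 1 x) ≤ v / 4 ^ (i + 1))
          (hy : dist (junction i 2) (copy i 2 y) ≤ v / 4 ^ (i + 1)) :
          (4 : ℝ) ^ i / 4 ^ (i + 1) ≤ dist (copy i 1 x) (copy i 2 y) := by
        have := dist_triangle4 (junction i 1) (copy i 1 x) (copy i 2 y) (junction i 2)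
        rw [dist_comm (copy i 2 y) (junction i 2)] at this
        linarith [dist_junction i]
      cases hb : b i <;> cases hb' : b' i
      · exact absurd (hb.trans hb'.symm) hne
      · rw [dist_comm]
        exact hsep _ _ (hclose 1 b') (hclose 2 b)
      · exact hsep _ _ (hclose 1 b) (hclose 2 b')
      · exact absurd (hb.trans hb'.symm) hne
    · obtain ⟨q, k, rfl, hq, hk⟩ := exists_quarter m n
      rw [mul_pow_add_mod him] at h1 h2
      have hkm : k < 4 ^ m := by
        by_cases h3 : q < 3
        · exact hk h3
        · obtain rfl : q = 3 := by omega
          rw [pow_succ] at hn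
          omega
      have hrec := ih k him hkm h1 h2
      have hcopy (e : Fin 6) :
          (4 : ℝ) ^ i / 4 ^ (m + 1) ≤ dist (copy m e (walk m k b)) (copy m e (walk m k b')) := by
        rw [dist_copy, pow_succ, ← div_div]
        linarith
      interval_cases q
      · rw [zero_mul, zero_add, walk_succ_first _ hkm.le, walk_succ_first _ hkm.le]
        exact hcopy 0
      · rw [one_mul, walk_succ_second _ hkm.le, walk_succ_second _ hkm.le, heq m him]
        exact hcopy _
      · rw [walk_succ_third _ hkm.le, walk_succ_third _ hkm.le, heq m him]
        exact hcopy _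
      · rw [walk_succ_fourth, walk_succ_fourth]
        exact hcopy _

end LaaksoVertex

/-! ### Frequency of separation times -/

/-- The times before `4 ^ m` in the second half of the way from a fork of level `i` to the middle of
the branches. -/
def separationTimes (m i : ℕ) : Finset ℕ :=
  (Finset.range (4 ^ m)).filter fun n =>
    3 * 4 ^ i ≤ 2 * (n % 4 ^ (i + 1)) ∧ n % 4 ^ (i + 1) ≤ 2 * 4 ^ i

/-- In each period of length `4 ^ (i + 1)` the admissible window has at least `4 ^ i / 2` points.
The injection records the period and the offset back from the middle of the branches. -/
theorem le_card_separationTimes {m i : ℕ} (h : i < m) :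
    4 ^ m ≤ 8 * (separationTimes m i).card := by
  obtain ⟨j, rfl⟩ : ∃ j, m = i + 1 + j := ⟨m - (i + 1), by omega⟩
  have h4 := Nat.pow_pos (n := i) (show 0 < 4 by norm_num)
  have key : (Finset.range (4 ^ j) ×ˢ Finset.range (4 ^ i / 2 + 1)).card ≤
      (separationTimes (i + 1 + j) i).card := by
    refine Finset.card_le_card_of_injOn
      (fun x => 4 ^ (i + 1) * x.1 + (2 * 4 ^ i - x.2)) ?_ ?_
    · rintro ⟨a, v⟩ hx
      simp only [Finset.coe_product, Finset.coe_range, Set.mem_prod, Set.mem_Iio] at hx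
      obtain ⟨ha, hv⟩ := hx
      have hlt : 2 * 4 ^ i - v < 4 ^ (i + 1) := by rw [pow_succ]; omega
      simp only [separationTimes, Finset.coe_filter, Finset.mem_range, Set.mem_ofPred_eq]
      rw [Nat.mul_add_mod, Nat.mod_eq_of_lt hlt]
      refine ⟨?_, by omega, by omega⟩
      calc 4 ^ (i + 1) * a + (2 * 4 ^ i - v) < 4 ^ (i + 1) * a + 4 ^ (i + 1) := by omega
        _ = 4 ^ (i + 1) * (a + 1) := by ring
        _ ≤ 4 ^ (i + 1) * 4 ^ j := Nat.mul_le_mul_left _ ha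
        _ = _ := (pow_add _ _ _).symm
    · rintro ⟨a, v⟩ hx ⟨a', v'⟩ hx' heq
      simp only [Finset.coe_product, Finset.coe_range, Set.mem_prod, Set.mem_Iio] at hx hx'
      have hlt : 2 * 4 ^ i - v < 4 ^ (i + 1) := by rw [pow_succ]; omega
      have hlt' : 2 * 4 ^ i - v' < 4 ^ (i + 1) := by rw [pow_succ]; omega
      have e1 := congrArg (· % 4 ^ (i + 1)) heq
      have e2 := congrArg (· / 4 ^ (i + 1)) heq
      simp only [Nat.mul_add_mod, Nat.mod_eq_of_lt hlt, Nat.mod_eq_of_lt hlt'] at e1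
      simp only [Nat.mul_add_div (Nat.pow_pos (n := i + 1) (show 0 < 4 by norm_num)),
        Nat.div_eq_of_lt hlt, Nat.div_eq_of_lt hlt', add_zero] at e2
      have : v = v' := by omega
      rw [this, e2]
  rw [Finset.card_product, Finset.card_range, Finset.card_range] at key
  have h2 : 4 ^ (i + 1 + j) ≤ 8 * (4 ^ j * (4 ^ i / 2 + 1)) := by
    have : 4 ^ (i + 1) ≤ 8 * (4 ^ i / 2 + 1) := by rw [pow_succ]; omega
    calc 4 ^ (i + 1 + j) = 4 ^ j * 4 ^ (i + 1) := by rw [pow_add _ (i + 1), mul_comm]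
      _ ≤ 4 ^ j * (8 * (4 ^ i / 2 + 1)) := Nat.mul_le_mul_left _ this
      _ = _ := by ring
  omega

/-! ### Expectations with respect to probability mass functions -/

namespace PMF

variable {α β : Type*}

theorem tsum_bind_mul (P : PMF α) (g : α → PMF β) (h : β → ℝ≥0∞) :
    ∑' z, (P.bind g) z * h z = ∑' w, P w * ∑' z, g w z * h z := by
  simp only [bind_apply, ← ENNReal.tsum_mul_right, ← ENNReal.tsum_mul_left]
  rw [ENNReal.tsum_comm]
  simp only [mul_assoc]

theorem tsum_map_mul (P : PMF α) (g : α → β) (h : β → ℝ≥0∞) :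
    ∑' z, (P.map g) z * h z = ∑' w, P w * h (g w) := by
  rw [← bind_pure_comp, tsum_bind_mul]
  refine tsum_congr fun w => ?_
  rw [tsum_eq_single (g w) fun b hb => by simp [pure_apply, hb]]
  simp

theorem tsum_mul_le_of_support (P : PMF α) {h : α → ℝ≥0∞} {U : ℝ≥0∞}
    (hU : ∀ x ∈ P.support, h x ≤ U) : ∑' x, P x * h x ≤ U := by
  calc ∑' x, P x * h x ≤ ∑' x, P x * U := by
        refine ENNReal.tsum_le_tsum fun x => ?_
        by_cases hx : x ∈ P.support
        · gcongr; exact hU x hx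
        · rw [mem_support_iff, not_not] at hx
          simp [hx]
    _ = U := by rw [ENNReal.tsum_mul_right, P.tsum_coe, one_mul]

theorem tsum_mul_mono_of_support (P : PMF α) {g h : α → ℝ≥0∞}
    (hgh : ∀ x ∈ P.support, g x ≤ h x) : ∑' x, P x * g x ≤ ∑' x, P x * h x := by
  refine ENNReal.tsum_le_tsum fun x => ?_
  by_cases hx : x ∈ P.support
  · gcongr; exact hgh x hx
  · rw [mem_support_iff, not_not] at hx
    simp [hx]

theorem le_tsum_mul_of_support (P : PMF α) {h : α → ℝ≥0∞} {U : ℝ≥0∞}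
    (hU : ∀ x ∈ P.support, U ≤ h x) : U ≤ ∑' x, P x * h x := by
  refine le_trans (le_of_eq ?_) (P.tsum_mul_mono_of_support hU)
  rw [ENNReal.tsum_mul_right, P.tsum_coe, one_mul]

end PMF

/-! ### The Markov chain of random walks through the Laakso graphs -/

/-- The bits that are renewed at time `t` are replaced by `c`. -/
def renewBits (t : ℤ) (c : Bool) (b : ℕ → Bool) : ℕ → Bool :=
  fun l => if t.toNat % 4 ^ (l + 1) = 4 ^ l then c else b l

theorem renewBits_of_nonpos {t : ℤ} (ht : t ≤ 0) (c : Bool) (b : ℕ → Bool) :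
    renewBits t c b = b := by
  funext l
  rw [renewBits, Int.toNat_of_nonpos ht, Nat.zero_mod, if_neg]
  exact (Nat.pow_pos (by norm_num)).ne

/-- The transition probabilities of the chain of times and bits. -/
noncomputable def bitStep (t : ℤ) (w : ℤ × (ℕ → Bool)) : PMF (ℤ × (ℕ → Bool)) :=
  (PMF.uniformOfFintype Bool).map fun c => (t + 1, renewBits t c w.2)

theorem bitStep_of_nonpos {t : ℤ} (ht : t ≤ 0) (w : ℤ × (ℕ → Bool)) :
    bitStep t w = PMF.pure (t + 1, w.2) := by
  simp only [bitStep, renewBits_of_nonpos ht]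
  exact PMF.map_const _ _

theorem mem_support_bitStep {t : ℤ} {w x : ℤ × (ℕ → Bool)} :
    x ∈ (bitStep t w).support ↔ ∃ c, x = (t + 1, renewBits t c w.2) := by
  simp [bitStep, eq_comm]

/-- The distribution of the times and bits at the natural number times. -/
noncomputable def bitLaw : ℕ → PMF (ℤ × (ℕ → Bool))
  | 0 => PMF.pure (0, fun _ => false)
  | n + 1 => (bitLaw n).bind (bitStep n)

/-- The Markov chain whose state consists of the time and of bits, the `l`-th of which is renewed at
the times congruent to `4 ^ l` modulo `4 ^ (l + 1)`. -/
noncomputable def bitChain : IntMarkovChain (ℤ × (ℕ → Bool)) where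
  law
    | Int.ofNat n => bitLaw n
    -- Up to time `0` no bit is renewed, so this deterministic past is compatible with `bitStep` and
    -- leads into `bitLaw 0`.
    | Int.negSucc n => PMF.pure (Int.negSucc n, fun _ => false)
  trans := bitStep
  law_succ t := by
    rcases t with n | n
    · rfl
    · change (PMF.pure (Int.negSucc n, fun _ => false)).bind (bitStep (Int.negSucc n)) = _
      rw [PMF.pure_bind, bitStep_of_nonpos (Int.negSucc_lt_zero n).le]
      rcases n with _ | n <;> rfl

theorem fst_of_mem_support_law {t : ℤ} {x : ℤ × (ℕ → Bool)} (h : x ∈ (bitChain.law t).support) :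
    x.1 = t := by
  rw [← sub_add_cancel t 1, ← bitChain.law_succ, PMF.mem_support_bind_iff] at h
  obtain ⟨w, -, hx⟩ := h
  obtain ⟨c, rfl⟩ := mem_support_bitStep.mp hx
  exact sub_add_cancel t 1

theorem mem_support_evolve_succ {s : ℤ} {n : ℕ} {w x : ℤ × (ℕ → Bool)}
    (h : x ∈ (bitChain.evolve s (n + 1) w).support) :
    ∃ y ∈ (bitChain.evolve s n w).support, ∃ c, x = (s + n + 1, renewBits (s + n) c y.2) := by
  rw [IntMarkovChain.evolve, PMF.mem_support_bind_iff] at h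
  obtain ⟨y, hy, hx⟩ := h
  exact ⟨y, hy, mem_support_bitStep.mp hx⟩

theorem fst_of_mem_support_evolve {s : ℤ} {n : ℕ} (hn : 0 < n) {w x : ℤ × (ℕ → Bool)}
    (h : x ∈ (bitChain.evolve s n w).support) : x.1 = s + n := by
  obtain ⟨k, rfl⟩ := Nat.exists_eq_succ_of_ne_zero hn.ne'
  obtain ⟨y, -, c, rfl⟩ := mem_support_evolve_succ h
  push_cast
  ring

theorem bit_of_mem_support_evolve {s : ℤ} {n l : ℕ} {w x : ℤ × (ℕ → Bool)}
    (hl : ∀ j < n, (s + j).toNat % 4 ^ (l + 1) ≠ 4 ^ l)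
    (h : x ∈ (bitChain.evolve s n w).support) : x.2 l = w.2 l := by
  induction n generalizing x with
  | zero =>
    rw [IntMarkovChain.evolve, PMF.mem_support_pure_iff] at h
    rw [h]
  | succ n ih =>
    obtain ⟨y, hy, c, rfl⟩ := mem_support_evolve_succ h
    rw [← ih (fun j hj => hl j (hj.trans (Nat.lt_succ_self n))) hy]
    exact if_neg (hl n (Nat.lt_succ_self n))

/-- A renewal makes the bit uniform whatever the preceding state, and later steps either renew it
again or leave it alone. -/
theorem map_bit_evolve {s : ℤ} {n i : ℕ} (w : ℤ × (ℕ → Bool))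
    (hi : ∃ j < n, (s + j).toNat % 4 ^ (i + 1) = 4 ^ i) :
    (bitChain.evolve s n w).map (fun x => x.2 i) = PMF.uniformOfFintype Bool := by
  induction n with
  | zero => obtain ⟨j, hj, -⟩ := hi; omega
  | succ n ih =>
    rw [IntMarkovChain.evolve, PMF.map_bind]
    by_cases hn : (s + n).toNat % 4 ^ (i + 1) = 4 ^ i
    · have (y : ℤ × (ℕ → Bool)) : (bitChain.trans (s + n) y).map (fun x => x.2 i) =
          PMF.uniformOfFintype Bool := by
        change (bitStep _ _).map _ = _
        rw [bitStep, PMF.map_comp]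
        convert PMF.map_id _ using 2
        funext c
        exact if_pos hn
      simp only [this, PMF.bind_const]
    · have (y : ℤ × (ℕ → Bool)) : (bitChain.trans (s + n) y).map (fun x => x.2 i) =
          PMF.pure (y.2 i) := by
        change (bitStep _ _).map _ = _
        rw [bitStep, PMF.map_comp]
        convert PMF.map_const _ _ using 2
        funext c
        exact if_neg hn
      simp only [this]
      refine (PMF.bind_pure_comp _ _).trans (ih ?_)
      obtain ⟨j, hj, hj'⟩ := hi
      refine ⟨j, ?_, hj'⟩
      rcases (Nat.lt_succ_iff.mp hj).eq_or_lt with rfl | h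
      · exact absurd hj' hn
      · exact h

/-- A bound on the expected displacement in one step of the chain. -/
theorem expDistPow_pair_le {X : Type*} [MetricSpace X] {p : ℝ} {F : ℤ × (ℕ → Bool) → X} {t : ℤ}
    {U : ℝ≥0∞} (h : ∀ b c, edist (F (t, renewBits (t - 1) c b)) (F (t - 1, b)) ^ p ≤ U) :
    expDistPow p F (bitChain.pair (t - 1) 1) ≤ U := by
  refine PMF.tsum_mul_le_of_support _ fun z hz => ?_
  rw [IntMarkovChain.pair, PMF.mem_support_bind_iff] at hz
  obtain ⟨⟨τ, b⟩, hw, hz⟩ := hz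
  obtain rfl : τ = t - 1 := fst_of_mem_support_law hw
  rw [PMF.mem_support_map_iff] at hz
  obtain ⟨x, hx, rfl⟩ := hz
  obtain ⟨y, hy, c, rfl⟩ := mem_support_evolve_succ hx
  rw [IntMarkovChain.evolve, PMF.mem_support_pure_iff] at hy
  subst hy
  simpa using h b c

/-- If the bit `i` is renewed between the times `s` and `s + n` and the later bits are not, then the
two branches of the forked chain differ in the bit `i` with probability one half. -/
theorem le_expDistPow_fork {X : Type*} [MetricSpace X] {p : ℝ} {F : ℤ × (ℕ → Bool) → X} {s : ℤ}
    {n i : ℕ} {U : ℝ≥0∞} (hi : ∃ j < n, (s + j).toNat % 4 ^ (i + 1) = 4 ^ i)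
    (hl : ∀ l, i < l → ∀ j < n, (s + j).toNat % 4 ^ (l + 1) ≠ 4 ^ l)
    (h : ∀ b b' : ℕ → Bool, b i ≠ b' i → (∀ l, i < l → b l = b' l) →
      U ≤ edist (F (s + n, b)) (F (s + n, b')) ^ p) :
    U / 2 ≤ expDistPow p F (bitChain.fork s n) := by
  have hn : 0 < n := by obtain ⟨j, hj, -⟩ := hi; omega
  rw [expDistPow, IntMarkovChain.fork, PMF.tsum_bind_mul]
  refine PMF.le_tsum_mul_of_support _ fun w _ => ?_
  rw [PMF.tsum_bind_mul]
  refine PMF.le_tsum_mul_of_support _ fun x hx => ?_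
  rw [PMF.tsum_map_mul]
  -- With `x` fixed, the lower bound depends on `y` only through its bit `i`, whose law is uniform;
  -- this yields the factor `1/2` without computing the joint law.
  have hbound : ∀ y ∈ (bitChain.evolve s n w).support,
      (if x.2 i = y.2 i then 0 else U) ≤ edist (F x) (F y) ^ p := by
    intro y hy
    split_ifs with hxy
    · exact zero_le
    · have h1 : x = (s + n, x.2) := Prod.ext (fst_of_mem_support_evolve hn hx) rfl
      have h2 : y = (s + n, y.2) := Prod.ext (fst_of_mem_support_evolve hn hy) rfl
      rw [h1, h2]
      exact h _ _ hxy fun l hil => (bit_of_mem_support_evolve (hl l hil) hx).trans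
        (bit_of_mem_support_evolve (hl l hil) hy).symm
  refine le_trans (le_of_eq ?_) (PMF.tsum_mul_mono_of_support _ hbound)
  have := PMF.tsum_map_mul (bitChain.evolve s n w) (fun y => y.2 i)
    (fun c => if x.2 i = c then 0 else U)
  rw [← this, map_bit_evolve w hi, tsum_bool]
  cases x.2 i <;> simp [ENNReal.div_eq_inv_mul]

/-! ### Distortion of Laakso graphs in Markov convex spaces -/

/-- The window of length `4 ^ i` ending at a separation time contains the fork of level `i` but no
multiple of `4 ^ (i + 1)`, whereas the bits above `i` are renewed only at such multiples. -/
theorem renewal_of_separation {n i : ℕ} (h1 : 3 * 4 ^ i ≤ 2 * (n % 4 ^ (i + 1)))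
    (h2 : n % 4 ^ (i + 1) ≤ 2 * 4 ^ i) :
    (∃ j : ℕ, j < 2 ^ (2 * i) ∧ ((n : ℤ) - 2 ^ (2 * i) + j).toNat % 4 ^ (i + 1) = 4 ^ i) ∧
      ∀ l, i < l → ∀ j : ℕ, j < 2 ^ (2 * i) →
        ((n : ℤ) - 2 ^ (2 * i) + j).toNat % 4 ^ (l + 1) ≠ 4 ^ l := by
  have e : (2 : ℕ) ^ (2 * i) = 4 ^ i := by rw [pow_mul]; norm_num
  have e' : (2 : ℤ) ^ (2 * i) = ((4 ^ i : ℕ) : ℤ) := by rw [pow_mul]; norm_num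
  have h4 := Nat.pow_pos (n := i) (show 0 < 4 by norm_num)
  rw [e, e']
  have hdiv := Nat.div_add_mod n (4 ^ (i + 1))
  set a := n / 4 ^ (i + 1)
  set u := n % 4 ^ (i + 1)
  have hnat (j : ℕ) : ((n : ℤ) - ((4 ^ i : ℕ) : ℤ) + j).toNat = 4 ^ (i + 1) * a + (u - 4 ^ i + j) := by
    omega
  simp only [hnat]
  have hpow : 4 ^ (i + 1) = 4 * 4 ^ i := by rw [pow_succ, mul_comm]
  refine ⟨⟨2 * 4 ^ i - u, by omega, ?_⟩, fun l hl j hj hmod => ?_⟩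
  · rw [Nat.mul_add_mod, Nat.mod_eq_of_lt (by omega)]
    omega
  · have hd : 4 ^ (i + 1) ∣ 4 ^ l := pow_dvd_pow 4 hl
    have hd' : 4 ^ (i + 1) ∣ 4 ^ (l + 1) := pow_dvd_pow 4 (by omega)
    have hm := congrArg (· % 4 ^ (i + 1)) hmod
    simp only [Nat.mod_mod_of_dvd _ hd', Nat.mod_eq_zero_of_dvd hd, Nat.mul_add_mod] at hm
    rw [Nat.mod_eq_of_lt (by omega)] at hm
    omega

/-- The test function shows the bit `0` at time `2` only, just after its renewal at time `1`. The
path can move only in the two steps around time `2`, while the term `k = 0`, `t = 2` already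
contributes `q / 2`. -/
theorem IsMarkovConvexWith.one_le_of_ne {p : ℝ} (hp : 0 < p) {X : Type*} [MetricSpace X] {C : ℝ≥0}
    (h : IsMarkovConvexWith p C X) {x y : X} (hxy : x ≠ y) : (1 : ℝ≥0∞) ≤ 4 * (C : ℝ≥0∞) ^ p := by
  set F : ℤ × (ℕ → Bool) → X := fun w => if w.1 = 2 ∧ w.2 0 = true then y else x with hF
  set q : ℝ≥0∞ := edist x y ^ p with hq
  have hq0 : q ≠ 0 := (ENNReal.rpow_pos (edist_pos.mpr hxy) (edist_ne_top x y)).ne'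
  have hqt : q ≠ ∞ := ENNReal.rpow_ne_top_of_nonneg hp.le (edist_ne_top x y)
  have hup : ∑' t : ℤ, expDistPow p F (bitChain.pair (t - 1) 1) ≤ 2 * q := by
    have hle (t : ℤ) : expDistPow p F (bitChain.pair (t - 1) 1) ≤ q := by
      refine expDistPow_pair_le fun b c => ?_
      refine ENNReal.rpow_le_rpow ?_ hp.le
      simp only [hF]
      split_ifs <;> simp [edist_comm]
    rw [tsum_eq_sum (s := {2, 3})]
    · refine (Finset.sum_le_card_nsmul _ _ q fun t _ => hle t).trans ?_
      simp
    · intro t ht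
      simp only [Finset.mem_insert, Finset.mem_singleton, not_or] at ht
      rw [← nonpos_iff_eq_zero]
      refine expDistPow_pair_le fun b c => ?_
      have h1 : F (t, renewBits (t - 1) c b) = x := if_neg fun h => ht.1 h.1
      have h2 : F (t - 1, b) = x := if_neg fun h => ht.2 (by have := h.1; simp only at this; omega)
      rw [h1, h2, edist_self, ENNReal.zero_rpow_of_pos hp]
  have hlow : q / 2 ≤ ∑' (k : ℕ) (t : ℤ),
      expDistPow p F (bitChain.fork (t - 2 ^ k) (2 ^ k)) / 2 ^ ((k : ℝ) * p) := by
    refine le_trans ?_ (ENNReal.le_tsum 0)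
    refine le_trans ?_ (ENNReal.le_tsum 2)
    have hren := renewal_of_separation (n := 2) (i := 0) (by norm_num) (by norm_num)
    have := le_expDistPow_fork (p := p) (F := F) (U := q) hren.1 hren.2 (by
      intro b b' hb _
      refine ENNReal.rpow_le_rpow ?_ hp.le
      have hs : ((2 : ℕ) : ℤ) - 2 ^ (2 * 0) + ((2 ^ (2 * 0) : ℕ) : ℤ) = 2 := by norm_num
      rw [hs]
      simp only [hF, true_and]
      cases h1 : b 0 <;> cases h2 : b' 0
      · exact absurd (h1.trans h2.symm) hb
      · simp
      · simp [edist_comm]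
      · exact absurd (h1.trans h2.symm) hb)
    simpa using this
  have := (hlow.trans (h _ bitChain F)).trans (mul_le_mul_right hup _)
  rw [ENNReal.div_le_iff (by norm_num) (by norm_num)] at this
  have h' : 1 * q ≤ 4 * (C : ℝ≥0∞) ^ p * q := by
    rw [one_mul]
    refine this.trans (le_of_eq ?_)
    ring
  exact (ENNReal.mul_le_mul_iff_left hq0 hqt).mp h'

-- The chain is run through the embedded graph, with `q` the `p`-th power of the least possible
-- image length of an edge. The right-hand sum is at most `4 ^ m * D ^ p * q`; each of the `m` even
-- scales `k = 2 * i` gives at least `4 ^ m * q / 16` on the left.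
open LaaksoVertex in
theorem IsMarkovConvexWith.le_distortion_rpow {p : ℝ} (hp : 0 < p) {X : Type*} [MetricSpace X]
    {C : ℝ≥0} (h : IsMarkovConvexWith p C X) {m : ℕ} {f : LaaksoVertex m → X} {r D : ℝ}
    (hr : 0 < r) (hD : 0 ≤ D) (h1 : ∀ x y, r * dist x y ≤ dist (f x) (f y))
    (h2 : ∀ x y, dist (f x) (f y) ≤ D * r * dist x y) :
    (m : ℝ≥0∞) ≤ 16 * ((C : ℝ≥0∞) ^ p * ENNReal.ofReal D ^ p) := by
  set F : ℤ × (ℕ → Bool) → X := fun w => f (walk m w.1.toNat w.2) with hF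
  have hrm : 0 < r / 4 ^ m := by positivity
  set q : ℝ≥0∞ := ENNReal.ofReal (r / 4 ^ m) ^ p with hq
  have hq0 : q ≠ 0 := (ENNReal.rpow_pos (by simpa using hrm) ENNReal.ofReal_ne_top).ne'
  have hqt : q ≠ ∞ := ENNReal.rpow_ne_top_of_nonneg hp.le ENNReal.ofReal_ne_top
  have hup : ∑' t : ℤ, expDistPow p F (bitChain.pair (t - 1) 1) ≤
      4 ^ m * (ENNReal.ofReal D ^ p * q) := by
    rw [tsum_eq_sum (s := Finset.Icc 1 (4 ^ m))]
    · refine (Finset.sum_le_card_nsmul _ _ (ENNReal.ofReal D ^ p * q) fun t ht => ?_).trans ?_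
      · rw [Finset.mem_Icc] at ht
        refine expDistPow_pair_le fun b c => ?_
        rw [hq, ← ENNReal.mul_rpow_of_nonneg _ _ hp.le, ← ENNReal.ofReal_mul hD]
        refine ENNReal.rpow_le_rpow ?_ hp.le
        rw [edist_dist]
        refine ENNReal.ofReal_le_ofReal ((h2 _ _).trans ?_)
        have e : t.toNat = (t - 1).toNat + 1 := by omega
        simp only [e]
        have := dist_walk_succ_le m (t - 1).toNat b (renewBits (t - 1) c b)
          fun l _ hl => if_neg hl
        calc D * r * _ ≤ D * r * (1 / 4 ^ m) := by gcongr
          _ = _ := by ring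
      · rw [Int.card_Icc, nsmul_eq_mul]
        have e : ((4 : ℤ) ^ m + 1 - 1).toNat = 4 ^ m := by
          rw [add_sub_cancel_right]
          exact Int.toNat_natCast (4 ^ m)
        rw [e]
        push_cast
        exact le_rfl
    · intro t ht
      rw [Finset.mem_Icc, not_and_or, not_le, not_le] at ht
      rw [← nonpos_iff_eq_zero]
      refine expDistPow_pair_le fun b c => ?_
      have e : F (t, renewBits (t - 1) c b) = F (t - 1, b) := by
        simp only [hF]
        rcases ht with ht | ht
        · rw [Int.toNat_of_nonpos (by omega), Int.toNat_of_nonpos (by omega), walk_zero, walk_zero]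
        · have e4 : ((4 ^ m : ℕ) : ℤ) = 4 ^ m := by push_cast; rfl
          rw [walk_of_le m _ (by omega), walk_of_le m _ (by omega)]
      rw [e, edist_self, ENNReal.zero_rpow_of_pos hp]
  have hlow : m * (4 ^ m * q) ≤ 16 * ∑' (k : ℕ) (t : ℤ),
      expDistPow p F (bitChain.fork (t - 2 ^ k) (2 ^ k)) / 2 ^ ((k : ℝ) * p) := by
    have hterm (i : ℕ) (hi : i < m) (n : ℕ) (hn : n ∈ separationTimes m i) : q / 2 ≤
        expDistPow p F (bitChain.fork ((n : ℤ) - 2 ^ (2 * i)) (2 ^ (2 * i))) /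
          2 ^ (((2 * i : ℕ) : ℝ) * p) := by
      simp only [separationTimes, Finset.mem_filter, Finset.mem_range] at hn
      obtain ⟨hn, hs1, hs2⟩ := hn
      obtain ⟨hr1, hr2⟩ := renewal_of_separation hs1 hs2
      have e2 : (2 : ℝ≥0∞) ^ (((2 * i : ℕ) : ℝ) * p) = ENNReal.ofReal (4 ^ i) ^ p := by
        rw [ENNReal.rpow_mul, ENNReal.rpow_natCast, pow_mul, ENNReal.ofReal_pow (by norm_num)]
        norm_num
      have hfork := le_expDistPow_fork (p := p) (F := F) (U := q * ENNReal.ofReal (4 ^ i) ^ p)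
        hr1 hr2 (by
          intro b b' hne heq
          rw [hq, ← ENNReal.mul_rpow_of_nonneg _ _ hp.le, ← ENNReal.ofReal_mul hrm.le]
          refine ENNReal.rpow_le_rpow ?_ hp.le
          have e : (n : ℤ) - 2 ^ (2 * i) + ((2 ^ (2 * i) : ℕ) : ℤ) = n := by
            push_cast
            rw [sub_add_cancel]
          rw [e, edist_dist]
          simp only [hF, Int.toNat_natCast]
          refine ENNReal.ofReal_le_ofReal (le_trans ?_ (h1 _ _))
          calc r / 4 ^ m * 4 ^ i = r * (4 ^ i / 4 ^ m) := by ring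
            _ ≤ _ := mul_le_mul_of_nonneg_left
              (le_dist_walk m i n b b' hi hn hs1 hs2 hne heq) hr.le)
      have h40 : ENNReal.ofReal (4 ^ i) ^ p ≠ 0 :=
        (ENNReal.rpow_pos (ENNReal.ofReal_pos.mpr (by positivity)) ENNReal.ofReal_ne_top).ne'
      have h4t : ENNReal.ofReal (4 ^ i) ^ p ≠ ∞ :=
        ENNReal.rpow_ne_top_of_nonneg hp.le ENNReal.ofReal_ne_top
      rw [e2, ENNReal.le_div_iff_mul_le (Or.inl h40) (Or.inl h4t)]
      refine le_trans (le_of_eq ?_) hfork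
      rw [ENNReal.div_eq_inv_mul, ENNReal.div_eq_inv_mul, mul_assoc]
    have hscale (i : ℕ) (hi : i < m) : 4 ^ m * q ≤ 16 * ∑' t : ℤ,
        expDistPow p F (bitChain.fork (t - 2 ^ (2 * i)) (2 ^ (2 * i))) /
          2 ^ (((2 * i : ℕ) : ℝ) * p) := by
      have hsum : (separationTimes m i).card • (q / 2) ≤ ∑' t : ℤ,
          expDistPow p F (bitChain.fork (t - 2 ^ (2 * i)) (2 ^ (2 * i))) /
            2 ^ (((2 * i : ℕ) : ℝ) * p) :=
        ((Finset.card_nsmul_le_sum _ _ _ (hterm i hi)).trans (ENNReal.sum_le_tsum _)).trans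
          (ENNReal.tsum_comp_le_tsum_of_injective Nat.cast_injective (fun t : ℤ =>
            expDistPow p F (bitChain.fork (t - 2 ^ (2 * i)) (2 ^ (2 * i))) /
              2 ^ (((2 * i : ℕ) : ℝ) * p)))
      -- The `16` is `8` from the frequency of separation times and `2` from the chance that the
      -- bits differ.
      refine le_trans ?_ (mul_le_mul_right hsum 16)
      have hc : (4 ^ m : ℝ≥0∞) ≤ 8 * (separationTimes m i).card := by
        exact_mod_cast le_card_separationTimes hi
      calc 4 ^ m * q ≤ 8 * (separationTimes m i).card * q := by gcongr
        _ = 8 * (separationTimes m i).card * (2 * (q / 2)) := by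
          rw [ENNReal.mul_div_cancel (by norm_num) (by norm_num)]
        _ = _ := by rw [nsmul_eq_mul]; ring
    have hinj : Function.Injective fun i : ℕ => 2 * i := fun i j hij => by simpa using hij
    have := Finset.card_nsmul_le_sum (Finset.range m) (fun i => 16 * ∑' t : ℤ,
        expDistPow p F (bitChain.fork (t - 2 ^ (2 * i)) (2 ^ (2 * i))) /
          2 ^ (((2 * i : ℕ) : ℝ) * p)) (4 ^ m * q) fun i hi => hscale i (Finset.mem_range.mp hi)
    rw [Finset.card_range, nsmul_eq_mul, ← Finset.mul_sum] at this
    refine this.trans (mul_le_mul_right ?_ 16)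
    exact (ENNReal.sum_le_tsum _).trans (ENNReal.tsum_comp_le_tsum_of_injective hinj fun k =>
      ∑' t : ℤ, expDistPow p F (bitChain.fork (t - 2 ^ k) (2 ^ k)) / 2 ^ ((k : ℝ) * p))
  have hall := hlow.trans (mul_le_mul_right
    ((h _ bitChain F).trans (mul_le_mul_right hup _)) 16)
  have hc0 : (4 : ℝ≥0∞) ^ m * q ≠ 0 := mul_ne_zero (by simp) hq0
  have hct : (4 : ℝ≥0∞) ^ m * q ≠ ∞ := ENNReal.mul_ne_top (by finiteness) hqt
  refine (ENNReal.mul_le_mul_iff_left hc0 hct).mp (hall.trans (le_of_eq ?_))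
  ring

theorem IsMarkovConvexWith.le_leastDistortion {p : ℝ} (hp : 2 ≤ p) {X : Type*} [MetricSpace X]
    {C : ℝ≥0} (h : IsMarkovConvexWith p C X) (m : ℕ) :
    ENNReal.ofReal (1 / 8 / C * Real.log (Fintype.card (LaaksoVertex m)) ^ (1 / p)) ≤
      leastDistortion (LaaksoVertex m) X := by
  refine ofReal_le_leastDistortion fun D r hD hr f h1 h2 => ?_
  have hp0 : 0 < p := by linarith
  -- Division by zero makes the claimed bound `0` here.
  rcases eq_or_ne C 0 with rfl | hC
  · simpa using hD.le
  have hC0 : (0 : ℝ) < C := by positivity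
  have hr1 : r ≤ dist (f (LaaksoVertex.source m)) (f (LaaksoVertex.sink m)) :=
    (le_mul_of_one_le_right hr.le (LaaksoVertex.dist_source_sink m)).trans (h1 _ _)
  have hne : f (LaaksoVertex.source m) ≠ f (LaaksoVertex.sink m) :=
    dist_pos.mp (hr.trans_le hr1)
  have hD1 : 1 ≤ D := by
    have h3 := (h1 (LaaksoVertex.source m) (LaaksoVertex.sink m)).trans (h2 _ _)
    have hd := LaaksoVertex.dist_source_sink m
    have hpos : 0 < r * dist (LaaksoVertex.source m) (LaaksoVertex.sink m) := by positivity
    rw [mul_assoc] at h3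
    exact le_of_mul_le_mul_right (by rwa [one_mul]) hpos
  have hcast : (C : ℝ≥0∞) = ENNReal.ofReal C := by simp
  have hA := h.one_le_of_ne hp0 hne
  have hB := h.le_distortion_rpow hp0 hr hD.le h1 h2
  rw [hcast, ENNReal.ofReal_rpow_of_pos hC0] at hA hB
  rw [ENNReal.ofReal_rpow_of_pos hD, ← ENNReal.ofReal_mul (by positivity)] at hB
  have hA' : (1 : ℝ) ≤ 4 * (C : ℝ) ^ p := by
    rw [← ENNReal.ofReal_one, ← ENNReal.ofReal_ofNat, ← ENNReal.ofReal_mul (by norm_num),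
      ENNReal.ofReal_le_ofReal_iff (by positivity)] at hA
    exact hA
  have hB' : (m : ℝ) ≤ 16 * ((C : ℝ) ^ p * D ^ p) := by
    rw [← ENNReal.ofReal_natCast, ← ENNReal.ofReal_ofNat, ← ENNReal.ofReal_mul (by norm_num),
      ENNReal.ofReal_le_ofReal_iff (by positivity)] at hB
    exact hB
  have hDp : 1 ≤ D ^ p := Real.one_le_rpow hD1 hp0.le
  have hCD : (C : ℝ) ^ p ≤ (C : ℝ) ^ p * D ^ p := le_mul_of_one_le_right (by positivity) hDp
  have hfin := LaaksoVertex.mul_log_card_rpow_le (p := p) (a := 1 / 8) (D := C * D) hp0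
    -- With `(1/8) ^ p ≤ 1/64`, `hB'` pays for the term in `m`, and `hA'` with `D ^ p ≥ 1` for the
    -- constant term.
    (by norm_num) (by positivity) m (by
      rw [Real.mul_rpow hC0.le hD.le]
      have h3 := Real.rpow_le_sq_of_le_one (a := 1 / 8) (by norm_num) (by norm_num) hp
      have h4 := mul_le_mul_of_nonneg_left h3 (by positivity : 0 ≤ 2 * ((m : ℝ) + 1))
      linarith)
  rw [div_mul_eq_mul_div, div_le_iff₀ hC0, mul_comm D]
  exact hfin

theorem theorem1p5 :
    -- embeddings into `p`-convex Banach spaces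
    (∀ p : ℝ, 2 ≤ p → ∀ (X : Type*) [NormedAddCommGroup X] [NormedSpace ℝ X] [CompleteSpace X],
      IsPConvex p X → ∃ c : ℝ, 0 < c ∧ ∀ m : ℕ,
        ENNReal.ofReal (c * Real.log (Fintype.card (LaaksoVertex m)) ^ (1 / p)) ≤
          leastDistortion (LaaksoVertex m) X) ∧
    -- embeddings into `L_p`
    (∃ c : ℝ, 0 < c ∧ ∀ p : ℝ, 2 < p → ∀ [Fact (1 ≤ ENNReal.ofReal p)]
      (S : Type*) [MeasurableSpace S] (μ : MeasureTheory.Measure S) (m : ℕ),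
        ENNReal.ofReal (c * Real.log (Fintype.card (LaaksoVertex m)) ^ (1 / p)) ≤
          leastDistortion (LaaksoVertex m) (MeasureTheory.Lp ℝ (ENNReal.ofReal p) μ)) ∧
    -- embeddings into Markov `p`-convex metric spaces
    (∃ c : ℝ, 0 < c ∧ ∀ p : ℝ, 2 ≤ p → ∀ (X : Type*) [MetricSpace X] (C : ℝ≥0),
      IsMarkovConvexWith p C X → ∀ m : ℕ,
        ENNReal.ofReal (c / C * Real.log (Fintype.card (LaaksoVertex m)) ^ (1 / p)) ≤
          leastDistortion (LaaksoVertex m) X) := by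
  refine ⟨fun p hp X _ _ _ hX => exists_le_leastDistortion_of_isPConvex hp hX,
    ⟨1 / 2, by norm_num, fun p hp _ S _ μ m => le_leastDistortion_Lp hp.le μ m⟩,
    ⟨1 / 8, by norm_num, fun p hp X _ C hX m => hX.le_leastDistortion hp m⟩⟩
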